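/- Let $(\Omega,\mathcal F,\mathbb P)$ be a probability space carrying three independent standard $d$-dimensional Brownian motions $B,B^Y,B^Z$. Let $X$ be the $d$-dimensional Ornstein–Uhlenbeck process $dX_t=\kappa(\theta-X_t)\,dt+\sigma\,dB_t$, $t\in[0,1]$, with deterministic initial value $X_0\in\mathbb R^d$, where $\kappa,\sigma\in\mathbb R^{d\times d}$ and $\theta\in\mathbb R^d$. All filtrations below are augmented by the $\mathbb P$-null events, and $\mathbb F^B=(\mathcal F^B_t)$ is the augmented natural filtration of $B$. **Assumptions.** Let 1. $\tau\in C[0,1]\cap C^1[0,1)$ be strictly increasing with $\tau(0)=0$, $\tau(1)=1$ and $\dot\tau>0$ on $[0,1)$ (one-sided derivative at $0$); 2. $\gamma,p,\omega\in C[0,1)$ be strictly positive; 3. $C_I,D_Z$ be symmetric positive definite $d\times d$ matrices; 4. $\omega_0\ge 0$ be such that $\int_0^1\omega(\tau(u))\,du<1-\omega_0$. For $N\ge1$ put $r^N_n=(n-1)2^{-N}$ $(1\le n\le 2^N+1)$, $t^N_n=\tau(r^N_n)$, $\omega^N_n=2^{-N}\omega(t^N_n)$ for $2\le n\le 2^N$,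 and $\omega^N_1=1-\omega_0-2^{-N}\sum_{n=2}^{2^N}\omega(t^N_n)$. Assume also that $$\lim_{N\to\infty}\omega^N_1=1-\omega_0-\int_0^1\omega(\tau(u))\,du\ (>0),$$ so that $\omega^N_1>0$ for all large $N$. **Markets.** For $1\le n\le 2^N$ let $\alpha^N_n=\omega^N_n/\gamma(t^N_n)$, $C^N_n=p(t^N_n)C_I$, $$Y^N_n=p(t^N_n)^{-1/2}C_I^{-1/2}\big(B^Y_n-B^Y_{n-1}\big),\qquad Z^N_n=D_Z^{-1/2}\int_{r^N_n}^{r^N_{n+1}}\sqrt{\dot\tau(u)}\,dB^Z_u ,$$ and let the $n$-th market signal of the $N$-th market be $$H^N_n=X_1+Y^N_n+\frac1{\alpha^N_n}\,(C^N_n)^{-1}Z^N_n .$$ The public filtration $\mathbb G^N$ of the $N$-th market is $\mathcal G^N_t=\mathcal F^B_t\vee\sigma(H^N_1,\dots,H^N_n)$ for $t^N_n\le t<t^N_{n+1}$. **Limit.** Let $\lambda=p\,\omega/\gamma$ and, for $t\in[0,1)$, $$F_t=p(0)C_I+\Big(\int_0^{\tau^{-1}(t)}\frac{\lambda(\tau(u))^2}{\dot\tau(u)}\,du\Big)C_ID_ZC_I,$$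 $$J_t=X_1+F_t^{-1}\Big(p(0)^{1/2}C_I^{1/2}B^Y_1+\int_0^{\tau^{-1}(t)}\frac{\lambda(\tau(u))}{\sqrt{\dot\tau(u)}}\,C_ID_Z^{1/2}\,dB^Z_u\Big),$$ and let $\mathbb G_0=\mathbb F^{B,J}$ be the augmented natural filtration of $(B,J)$, that is, $(\mathcal G_0)_t=\sigma(B_s,J_s:\,s\le t)\vee\{\mathbb P\text{-null events}\}$. **Claim.** $\mathbb G^N$ converges to $\mathbb G_0$ in $L^p$ over $[0,1)$ for every $p\in[1,\infty)$: for every $t\in[0,1)$ and every $A\in(\mathcal G_0)_t$, $\mathbb E[1_A\mid\mathcal G^N_t]\to1_A$ in $L^p$ as $N\to\infty$; and also, for every $Y\in L^p(\Omega,(\mathcal G_0)_t,\mathbb P)$, $\mathbb E[Y\mid\mathcal G^N_t]\to Y$ in $L^p$. -/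

import Mathlib

open MeasureTheory ProbabilityTheory Filter Topology
open scoped NNReal ENNReal

namespace SignalLimit

noncomputable section

/-! ### Brownian motion, the Ornstein-Uhlenbeck process, Wiener integrals -/

/-- `W` is a standard `d`-dimensional Brownian motion: its coordinates are independent standard
real Brownian motions. -/
structure IsBrownianVec {Ω : Type*} {mΩ : MeasurableSpace Ω} {d : ℕ}
    (W : ℝ≥0 → Ω → Fin d → ℝ) (P : Measure Ω) : Prop where
  measurable : ∀ t, Measurable (W t)
  coord : ∀ i, IsBrownianReal (fun t ω => W t ω i) P
  indep : iIndepFun (fun (i : Fin d) (ω : Ω) (t : ℝ≥0) => W t ω i) P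

/-- `X` solves `dX = κ (θ - X) dt + σ dB`, `X 0 = x₀`, on the time interval `[0, 1]`. The noise is
additive, so that the equation is a pathwise integral equation. -/
structure IsOrnsteinUhlenbeck {Ω : Type*} {mΩ : MeasurableSpace Ω} {d : ℕ}
    (κ σ : Matrix (Fin d) (Fin d) ℝ) (θ x₀ : Fin d → ℝ)
    (B X : ℝ≥0 → Ω → Fin d → ℝ) (P : Measure Ω) : Prop where
  measurable : ∀ t, Measurable (X t)
  sde : ∀ᵐ ω ∂P, ContinuousOn (fun t : ℝ≥0 => X t ω) (Set.Iic 1) ∧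
    ∀ t : ℝ≥0, t ≤ 1 →
      X t ω = x₀ + (∫ s in (0 : ℝ)..t, κ.mulVec (θ - X s.toNNReal ω)) + σ.mulVec (B t ω)

/-- Lebesgue measure on the time axis `(0, ∞)`. -/
abbrev timeMeasure : Measure ℝ := volume.restrict (Set.Ioi 0)

lemma timeMeasure_Ioc_ne_top (t : ℝ≥0) : timeMeasure (Set.Ioc (0 : ℝ) t) ≠ ∞ :=
  ((Measure.restrict_apply_le _ _).trans_lt measure_Ioc_lt_top).ne

/-- The step functions: the formal sum `∑ cᵢ tᵢ` is sent to `∑ cᵢ 1_(0, tᵢ]` in `L²(0, ∞)`. -/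
def stepFunction : (ℝ≥0 →₀ ℝ) →ₗ[ℝ] Lp ℝ 2 timeMeasure :=
  Finsupp.linearCombination ℝ fun t =>
    indicatorConstLp 2 (measurableSet_Ioc : MeasurableSet (Set.Ioc (0 : ℝ) t))
      (timeMeasure_Ioc_ne_top t) (1 : ℝ)

open Classical in
/-- The elementary Wiener integral: the integral of `∑ cᵢ 1_(0, tᵢ]` is `∑ cᵢ W_{tᵢ}`. -/
def elementaryIntegral {Ω : Type*} {mΩ : MeasurableSpace Ω} (W : ℝ≥0 → Ω → ℝ) (P : Measure Ω) :
    (ℝ≥0 →₀ ℝ) →ₗ[ℝ] Lp ℝ 2 P :=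
  Finsupp.linearCombination ℝ fun t => if h : MemLp (W t) 2 P then h.toLp (W t) else 0

lemma stepFunction_single (t : ℝ≥0) : stepFunction (Finsupp.single t 1) =
    indicatorConstLp 2 (measurableSet_Ioc : MeasurableSet (Set.Ioc (0 : ℝ) t))
      (timeMeasure_Ioc_ne_top t) (1 : ℝ) := by
  simp [stepFunction]

/-- The step functions are dense in `L²(0, ∞)`. -/
lemma denseRange_stepFunction : DenseRange stepFunction := by
  have key : (LinearMap.range stepFunction)ᗮ = ⊥ := by
    rw [Submodule.eq_bot_iff]
    intro f hf
    have h0 : ∀ t : ℝ≥0, ∫ x in Set.Ioc (0:ℝ) t, f x ∂timeMeasure = 0 := by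
      intro t
      rw [← L2.inner_indicatorConstLp_one (𝕜 := ℝ) measurableSet_Ioc (timeMeasure_Ioc_ne_top t) f,
        ← stepFunction_single]
      exact hf _ (LinearMap.mem_range_self _ _)
    set g : ℝ → ℝ := (Set.Ioi (0:ℝ)).indicator f
    have hg : LocallyIntegrable g volume := by
      have h2 : MemLp g 2 volume := (memLp_indicator_iff_restrict measurableSet_Ioi).2 (Lp.memLp f)
      exact h2.locallyIntegrable (by norm_num)
    have hz : ∀ x, ∫ t in (0:ℝ)..x, g t = 0 := by
      intro x
      rcases le_total 0 x with hx | hx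
      · rw [intervalIntegral.integral_of_le hx]
        have := h0 ⟨x, hx⟩
        rw [Measure.restrict_restrict measurableSet_Ioc] at this
        rw [setIntegral_indicator measurableSet_Ioi]
        exact this
      · rw [intervalIntegral.integral_of_ge hx, neg_eq_zero]
        apply setIntegral_eq_zero_of_forall_eq_zero
        intro y hy
        exact Set.indicator_of_notMem (by simpa using hy.2) _
    have hae := LocallyIntegrable.ae_hasDerivAt_integral hg
    have hg0 : ∀ᵐ x, g x = 0 := by
      filter_upwards [hae] with x hx
      have h1 := hx 0
      simp only [hz] at h1
      exact h1.unique (hasDerivAt_const x (0:ℝ))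
    rw [Lp.eq_zero_iff_ae_eq_zero]
    rw [Filter.EventuallyEq, ae_restrict_iff' measurableSet_Ioi]
    filter_upwards [hg0] with x hx hx'
    simpa [g, Set.indicator_of_mem hx'] using hx
  have := (Submodule.topologicalClosure_eq_top_iff).2 key
  rw [DenseRange, ← LinearMap.coe_range]
  exact (Submodule.dense_iff_topologicalClosure_eq_top).2 this

/-- The elementary Wiener integral against a Brownian motion is isometric; so `extendOfNorm` below
is the extension by continuity. -/
lemma norm_elementaryIntegral {Ω : Type*} {mΩ : MeasurableSpace Ω} {P : Measure Ω} {W : ℝ≥0 → Ω → ℝ}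
    (hW : IsPreBrownianReal W P) (φ : ℝ≥0 →₀ ℝ) :
    ‖elementaryIntegral W P φ‖ = ‖stepFunction φ‖ := by
  have : IsProbabilityMeasure P := hW.isGaussianProcess.isProbabilityMeasure
  have hm : ∀ t, MemLp (W t) 2 P := fun t => (hW.isGaussianProcess.hasGaussianLaw_eval t).memLp_two
  have h1 : inner ℝ (elementaryIntegral W P φ) (elementaryIntegral W P φ)
      = inner ℝ (stepFunction φ) (stepFunction φ) := by
    simp only [elementaryIntegral, stepFunction, Finsupp.linearCombination_apply, Finsupp.sum,
      sum_inner, inner_sum, inner_smul_left, inner_smul_right, hm, dif_pos]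
    refine Finset.sum_congr rfl fun s _ => ?_
    congr 1
    refine Finset.sum_congr rfl fun t _ => ?_
    congr 1
    rw [L2.real_inner_indicatorConstLp_one_indicatorConstLp_one _ _ (timeMeasure_Ioc_ne_top _)
      (timeMeasure_Ioc_ne_top _), L2.inner_def]
    have e1 : ∫ a, inner ℝ ((hm t).toLp (W t) a) ((hm s).toLp (W s) a) ∂P = ∫ a, W t a * W s a ∂P := by
      apply integral_congr_ae
      filter_upwards [(hm s).coeFn_toLp, (hm t).coeFn_toLp] with a ha hb
      simp [ha, hb, mul_comm]
    rw [e1]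
    have := hW.covariance_eval t s
    rw [covariance_eq_sub (hm t) (hm s), hW.integral_eval, zero_mul, sub_zero] at this
    simp only [Pi.mul_apply] at this
    rw [this, timeMeasure, Measure.real, Measure.restrict_apply (by measurability)]
    rw [Set.Ioc_inter_Ioc, Set.inter_eq_left.2]
    · simp only [Real.volume_Ioc, max_self, sub_zero]
      rw [NNReal.coe_min]
      exact (ENNReal.toReal_ofReal (le_min t.2 s.2)).symm
    · intro x hx; simpa using hx.1
  rw [real_inner_self_eq_norm_sq, real_inner_self_eq_norm_sq] at h1
  exact (sq_eq_sq₀ (norm_nonneg _) (norm_nonneg _)).1 h1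

open Classical in
/-- The Wiener integral `∫_a^b f dW` (`0 ≤ a`) of a deterministic square integrable function
against a real Brownian motion: the continuous extension to `L²(0, ∞)` of the elementary integral,
applied to `f 1_(a, b]`. -/
def wienerIntegral {Ω : Type*} {mΩ : MeasurableSpace Ω} (W : ℝ≥0 → Ω → ℝ) (P : Measure Ω)
    (f : ℝ → ℝ) (a b : ℝ) : Ω → ℝ :=
  if h : MemLp ((Set.Ioc a b).indicator f) 2 timeMeasure then
    ((elementaryIntegral W P).extendOfNorm stepFunction (h.toLp _) : Lp ℝ 2 P)
  else 0

/-- The Wiener integral of a scalar function against a vector Brownian motion, coordinatewise. -/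
def wienerIntegralVec {Ω : Type*} {mΩ : MeasurableSpace Ω} {d : ℕ} (W : ℝ≥0 → Ω → Fin d → ℝ)
    (P : Measure Ω) (f : ℝ → ℝ) (a b : ℝ) (ω : Ω) : Fin d → ℝ :=
  fun i => wienerIntegral (fun t ω' => W t ω' i) P f a b ω

open scoped MatrixOrder in
/-- The positive semidefinite square root of a positive semidefinite matrix. -/
def matSqrt {d : ℕ} (A : Matrix (Fin d) (Fin d) ℝ) : Matrix (Fin d) (Fin d) ℝ := CFC.sqrt A

/-! ### `L^p` convergence of `σ`-algebras -/

/-- `G N` converges to `G₀` in `L^p`: the conditional expectations given `G N` of the indicators of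
sets of `G₀`, and of the elements of `L^p(G₀)`, converge to these in `L^p`. -/
structure SigmaAlgebraConvergesLp {Ω : Type*} {mΩ : MeasurableSpace Ω} (P : Measure Ω) (p : ℝ≥0∞)
    (G : ℕ → MeasurableSpace Ω) (G₀ : MeasurableSpace Ω) : Prop where
  indicator : ∀ A : Set Ω, MeasurableSet[G₀] A →
    Tendsto (fun N => eLpNorm (P[A.indicator (fun _ => (1 : ℝ)) | G N] -
      A.indicator (fun _ => (1 : ℝ))) p P) atTop (𝓝 0)
  memLp : ∀ Y : Ω → ℝ, StronglyMeasurable[G₀] Y → MemLp Y p P →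
    Tendsto (fun N => eLpNorm (P[Y | G N] - Y) p P) atTop (𝓝 0)

/-- `L^p` convergence of filtrations over the time interval `[0, 1)`. -/
def FiltrationConvergesLp {Ω : Type*} {mΩ : MeasurableSpace Ω} (P : Measure Ω) (p : ℝ≥0∞)
    (G : ℕ → ℝ → MeasurableSpace Ω) (G₀ : ℝ → MeasurableSpace Ω) : Prop :=
  ∀ t ∈ Set.Ico (0 : ℝ) 1, SigmaAlgebraConvergesLp P p (fun N => G N t) (G₀ t)

/-- The `σ`-algebra generated by the `P`-null events. -/
@[reducible] def nullEvents {Ω : Type*} {mΩ : MeasurableSpace Ω} (P : Measure Ω) : MeasurableSpace Ω :=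
  MeasurableSpace.generateFrom {A | MeasurableSet A ∧ P A = 0}

/-- The `P`-augmented natural filtration of `B`. -/
@[reducible] def brownianFiltration {Ω : Type*} {mΩ : MeasurableSpace Ω} {d : ℕ} (P : Measure Ω)
    (B : ℝ≥0 → Ω → Fin d → ℝ) (t : ℝ) : MeasurableSpace Ω :=
  (⨆ s : {s : ℝ≥0 // (s : ℝ) ≤ t}, MeasurableSpace.comap (B s) inferInstance) ⊔ nullEvents P

/-! ### The sequence of markets -/

/-- The deterministic data of the sequence of markets: time change `τ`, risk aversions `γ`, signal
precisions `p`, insiders' weights `w`, weight `w₀` of the uninformed agent, matrices `C` of the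
insiders' precision and `D` of the noise traders' precision. -/
structure MarketData (d : ℕ) where
  τ : ℝ → ℝ
  γ : ℝ → ℝ
  p : ℝ → ℝ
  w : ℝ → ℝ
  w₀ : ℝ
  C : Matrix (Fin d) (Fin d) ℝ
  D : Matrix (Fin d) (Fin d) ℝ

/-- The dyadic rational `r^N_n = (n - 1) / 2^N`. -/
def dyadic (N n : ℕ) : ℝ := ((n : ℝ) - 1) / 2 ^ N

namespace MarketData

variable {d : ℕ} (M : MarketData d)

/-- The derivative of `τ` on `[0, 1)`, one-sided at `0`. -/
def τ' (u : ℝ) : ℝ := derivWithin M.τ (Set.Ico 0 1) u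

/-- The inverse of `τ : [0, 1] → [0, 1]`. -/
def τInv (t : ℝ) : ℝ := Function.invFunOn M.τ (Set.Icc 0 1) t

/-- The signal time `t^N_n` of the `n`-th insider, `1 ≤ n ≤ 2^N`. -/
def signalTime (N n : ℕ) : ℝ := M.τ (dyadic N n)

/-- The weight of the `n`-th insider, `1 ≤ n ≤ 2^N`. -/
def weight (N n : ℕ) : ℝ :=
  if n = 1 then 1 - M.w₀ - (∑ m ∈ Finset.Icc 2 (2 ^ N), M.w (M.signalTime N m)) / 2 ^ N
  else M.w (M.signalTime N n) / 2 ^ N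

/-- The weighted risk tolerance `α^N_n` of the `n`-th insider. -/
def riskTolerance (N n : ℕ) : ℝ := M.weight N n / M.γ (M.signalTime N n)

/-- The precision matrix `C^N_n` of the `n`-th insider. -/
def precision (N n : ℕ) : Matrix (Fin d) (Fin d) ℝ := M.p (M.signalTime N n) • M.C

/-- The scaling assumptions. -/
structure ScalingAssumption : Prop where
  τ_continuousOn : ContinuousOn M.τ (Set.Icc 0 1)
  τ_contDiffOn : ContDiffOn ℝ 1 M.τ (Set.Ico 0 1)
  τ_strictMonoOn : StrictMonoOn M.τ (Set.Icc 0 1)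
  τ_zero : M.τ 0 = 0
  τ_one : M.τ 1 = 1
  τ'_pos : ∀ u ∈ Set.Ico (0 : ℝ) 1, 0 < M.τ' u
  γ_continuousOn : ContinuousOn M.γ (Set.Ico 0 1)
  γ_pos : ∀ t ∈ Set.Ico (0 : ℝ) 1, 0 < M.γ t
  p_continuousOn : ContinuousOn M.p (Set.Ico 0 1)
  p_pos : ∀ t ∈ Set.Ico (0 : ℝ) 1, 0 < M.p t
  w_continuousOn : ContinuousOn M.w (Set.Ico 0 1)
  w_pos : ∀ t ∈ Set.Ico (0 : ℝ) 1, 0 < M.w t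
  w₀_nonneg : 0 ≤ M.w₀
  C_posDef : M.C.PosDef
  D_posDef : M.D.PosDef
  w_integrable : IntervalIntegrable (fun u => M.w (M.τ u)) volume 0 1
  w_integral_lt : ∫ u in (0 : ℝ)..1, M.w (M.τ u) < 1 - M.w₀
  weight_one_tendsto : Tendsto (fun N => M.weight N 1) atTop
    (𝓝 (1 - M.w₀ - ∫ u in (0 : ℝ)..1, M.w (M.τ u)))

section Signals

variable {Ω : Type*} {mΩ : MeasurableSpace Ω} (P : Measure Ω) (B BY BZ X : ℝ≥0 → Ω → Fin d → ℝ)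

/-- The noise `Y^N_n = p(t^N_n)^{-1/2} C^{-1/2} (BY_n - BY_{n-1})` in the `n`-th private signal. -/
def privateNoise (N n : ℕ) (ω : Ω) : Fin d → ℝ :=
  (√(M.p (M.signalTime N n)))⁻¹ •
    ((matSqrt M.C)⁻¹).mulVec (BY (n : ℝ≥0) ω - BY ((n - 1 : ℕ) : ℝ≥0) ω)

/-- The incremental demand `Z^N_n = D^{-1/2} ∫ √τ' dBZ` of the noise traders, the integral being
over `(r^N_n, r^N_{n+1}]`. -/
def noiseDemand (N n : ℕ) (ω : Ω) : Fin d → ℝ :=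
  ((matSqrt M.D)⁻¹).mulVec
    (wienerIntegralVec BZ P (fun u => √(M.τ' u)) (dyadic N n) (dyadic N (n + 1)) ω)

/-- The private signal `G^N_n = X_1 + Y^N_n` of the `n`-th insider. -/
def privateSignal (N n : ℕ) (ω : Ω) : Fin d → ℝ := X 1 ω + M.privateNoise BY N n ω

/-- The market signal `H^N_n = G^N_n + (α^N_n)⁻¹ (C^N_n)⁻¹ Z^N_n`. -/
def marketSignal (N n : ℕ) (ω : Ω) : Fin d → ℝ :=
  M.privateSignal BY X N n ω +
    (M.riskTolerance N n)⁻¹ • ((M.precision N n)⁻¹).mulVec (M.noiseDemand P BZ N n ω)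

/-- The public filtration of the `N`-th market: at time `t` it is generated by the augmented
Brownian filtration and the market signals which have arrived by time `t`. -/
@[reducible] def publicFiltration (N : ℕ) (t : ℝ) : MeasurableSpace Ω :=
  brownianFiltration P B t ⊔
    ⨆ n : {n : ℕ // 1 ≤ n ∧ n ≤ 2 ^ N ∧ M.signalTime N n ≤ t},
      MeasurableSpace.comap (M.marketSignal P BY BZ X N n) inferInstance

/-- The risk tolerance weighted precision function `λ = p w / γ`. -/
def lam (t : ℝ) : ℝ := M.p t * M.w t / M.γ t

/-- The precision `F_t` of the limiting signal, `0 ≤ t < 1`. -/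
def limitPrecision (t : ℝ) : Matrix (Fin d) (Fin d) ℝ :=
  M.p 0 • M.C +
    (∫ u in (0 : ℝ)..(M.τInv t), M.lam (M.τ u) ^ 2 / M.τ' u) • (M.C * M.D * M.C)

/-- The limiting signal `J_t`, `0 ≤ t < 1`. -/
def limitSignal (t : ℝ) (ω : Ω) : Fin d → ℝ :=
  X 1 ω + ((M.limitPrecision t)⁻¹).mulVec
    (√(M.p 0) • (matSqrt M.C).mulVec (BY 1 ω) +
      (M.C * matSqrt M.D).mulVec
        (wienerIntegralVec BZ P (fun u => M.lam (M.τ u) / √(M.τ' u)) 0 (M.τInv t) ω))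

/-- The limiting filtration: the `P`-augmented natural filtration of `B` and the limiting signal. -/
@[reducible] def limitFiltration (t : ℝ) : MeasurableSpace Ω :=
  brownianFiltration P B t ⊔
    ⨆ s : {s : ℝ // 0 ≤ s ∧ s ≤ t}, MeasurableSpace.comap (M.limitSignal P BY BZ X s) inferInstance

end Signals

end MarketData

end

end SignalLimit

/-! Events approximable in probability by events of `G N` form a σ-algebra, `asymptoticEvents`. If
it contains `G₀`, then `L^p` convergence follows: up to a factor 2, conditional expectation is the
best `L^p` approximation, which settles indicators, and density of simple functions settles
`L^p(G₀)`. So it suffices to approximate generators of `G₀`. The Brownian part lies in every `G N`;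
for `J_s` a limit in probability of publicly measurable variables is needed.

That limit is a precision-weighted average of the market signals, `approxSignal`. Since `α_n p(t_n)
= 2^{-N} λ(t_n)` for `n ≥ 2`, give `H_n` the weight `(λ/τ') α_n p C D C`, and `H_1` the weight `p(0)
C`. Then the coefficients of `X_1` form a Riemann sum of `λ²/τ'`; the demand noises form the Wiener
integral of a step approximation of `λ/τ'` times `√τ'`, with limit `∫ λ/√τ' dBZ`; the private noises
for `n ≥ 2` are at most `2^N` unit increments with weights `O(2^{-N})`, hence `O(2^{-N/2})` in `L²`;
and the demand noise in `H_1` lives on an interval of length `2^{-N}` while `α_1` stays away from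
`0`. Only `BY_1` survives of the private noise. The Wiener isometry turns these limits into
deterministic `L²` limits, and `tendstoInMeasure_approxSignal` assembles them. -/

namespace SignalLimit

open scoped symmDiff

/-! ### Asymptotic events and `L^p` convergence of σ-algebras -/

section SigmaAlgebras

variable {Ω : Type*} {mΩ : MeasurableSpace Ω}

/-- The events which are approximated in probability by events of `G N` as `N → ∞`. -/
@[reducible] def asymptoticEvents (P : Measure Ω) [IsFiniteMeasure P] (G : ℕ → MeasurableSpace Ω) :
    MeasurableSpace Ω where
  MeasurableSet' A := MeasurableSet A ∧
    ∀ ε : ℝ≥0∞, 0 < ε → ∀ᶠ N in atTop, ∃ A', MeasurableSet[G N] A' ∧ P (A ∆ A') ≤ ε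
  measurableSet_empty :=
    ⟨.empty, fun ε _ => .of_forall fun N => ⟨∅, @MeasurableSet.empty _ (G N), by simp⟩⟩
  measurableSet_compl A hA := by
    refine ⟨hA.1.compl, fun ε hε => (hA.2 ε hε).mono fun N => ?_⟩
    rintro ⟨A', h, hA'⟩
    exact ⟨A'ᶜ, h.compl, by rwa [compl_symmDiff_compl]⟩
  measurableSet_iUnion f hf := by
    have hmeas : ∀ i, MeasurableSet (f i) := fun i => (hf i).1
    -- The threshold for `N` depends on the event, so only finitely many approximations can be
    -- combined at once; the tail of the union is then discarded by continuity of `P` from above.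
    have hacc : ∀ n, ∀ ε : ℝ≥0∞, 0 < ε → ∀ᶠ N in atTop,
        ∃ A', MeasurableSet[G N] A' ∧ P (Set.accumulate f n ∆ A') ≤ ε := by
      intro n
      induction n with
      | zero =>
        intro ε hε
        simpa [Set.accumulate_def] using (hf 0).2 ε hε
      | succ n ih =>
        intro ε hε
        have h2 : 0 < ε / 2 := ENNReal.half_pos hε.ne'
        filter_upwards [ih _ h2, (hf (n + 1)).2 _ h2] with N
        rintro ⟨A', hA', hA''⟩ ⟨A₁, hA₁, hA₁'⟩
        refine ⟨A' ∪ A₁, hA'.union hA₁, ?_⟩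
        have hsub : Set.accumulate f (n + 1) ∆ (A' ∪ A₁) ⊆
            Set.accumulate f n ∆ A' ∪ f (n + 1) ∆ A₁ := by
          rw [Set.accumulate_succ]
          exact Set.union_symmDiff_union_subset ..
        calc P (Set.accumulate f (n + 1) ∆ (A' ∪ A₁))
            ≤ P (Set.accumulate f n ∆ A') + P (f (n + 1) ∆ A₁) :=
              (measure_mono hsub).trans (measure_union_le _ _)
          _ ≤ ε := (add_le_add hA'' hA₁').trans_eq (ENNReal.add_halves ε)
    refine ⟨.iUnion hmeas, fun ε hε => ?_⟩
    have h2 : 0 < ε / 2 := ENNReal.half_pos hε.ne'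
    have hdiff : Tendsto (fun n => P ((⋃ i, f i) \ Set.accumulate f n)) atTop (𝓝 0) := by
      have := tendsto_measure_iInter_atTop (μ := P)
        (s := fun n => (⋃ i, f i) \ Set.accumulate f n)
        (fun n => ((MeasurableSet.iUnion hmeas).diff
          (.biUnion (Set.to_countable _) fun i _ => hmeas i)).nullMeasurableSet)
        (fun m n hmn => Set.sdiff_subset_sdiff_right (Set.monotone_accumulate hmn))
        ⟨0, measure_ne_top _ _⟩
      rwa [← Set.sdiff_iUnion, Set.iUnion_accumulate, sdiff_self, Set.bot_eq_empty,
        measure_empty] at this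
    obtain ⟨n, hn⟩ := (hdiff.eventually_le_const h2).exists
    filter_upwards [hacc n _ h2] with N
    rintro ⟨A', hA', hA''⟩
    refine ⟨A', hA', ?_⟩
    have hsymm : (⋃ i, f i) ∆ Set.accumulate f n = (⋃ i, f i) \ Set.accumulate f n := by
      rw [Set.symmDiff_def, Set.sdiff_eq_empty.2 (Set.accumulate_subset_iUnion n), Set.union_empty]
    calc P ((⋃ i, f i) ∆ A')
        ≤ P ((⋃ i, f i) ∆ Set.accumulate f n) + P (Set.accumulate f n ∆ A') :=
          measure_symmDiff_le _ _ _
      _ ≤ ε := by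
          rw [hsymm]
          exact (add_le_add hn hA'').trans_eq (ENNReal.add_halves ε)

variable {P : Measure Ω} [IsFiniteMeasure P] {G : ℕ → MeasurableSpace Ω}

lemma le_asymptoticEvents {m : MeasurableSpace Ω} (hm : m ≤ mΩ) (h : ∀ N, m ≤ G N) :
    m ≤ asymptoticEvents P G := fun A hA =>
  ⟨hm A hA, fun ε _ => .of_forall fun N => ⟨A, h N A hA, by simp⟩⟩

/-- A real random variable which is the limit in probability of `G N`-measurable ones is measurable
with respect to the asymptotic events. -/
lemma measurable_asymptoticEvents_of_tendstoInMeasure {f : Ω → ℝ} {g : ℕ → Ω → ℝ}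
    (hf : Measurable f) (hg : ∀ N, Measurable[G N] (g N)) (h : TendstoInMeasure P g atTop f) :
    Measurable[asymptoticEvents P G] f := by
  refine measurable_of_Ioi (mδ := asymptoticEvents P G) fun a => ?_
  refine ⟨hf measurableSet_Ioi, fun ε hε => ?_⟩
  have h2 : 0 < ε / 2 := ENNReal.half_pos hε.ne'
  -- Compare `{f > a}` with `{g N > a + δ}`: they differ only where `a < f ≤ a + 2δ` or `|g N - f| ≥
  -- δ`. Raising the threshold makes the strip exclude `f = a`, so its probability vanishes with `δ`
  -- even if `f` has an atom at `a`.
  have hstrip : Tendsto (fun k : ℕ => P (f ⁻¹' Set.Ioc a (a + 2 * (1 / ((k : ℝ) + 1))))) atTop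
      (𝓝 0) := by
    have := tendsto_measure_iInter_atTop (μ := P)
      (s := fun k : ℕ => f ⁻¹' Set.Ioc a (a + 2 * (1 / ((k : ℝ) + 1))))
      (fun k => (hf measurableSet_Ioc).nullMeasurableSet)
      (fun m n hmn => Set.preimage_mono (Set.Ioc_subset_Ioc_right (by
        gcongr)))
      ⟨0, measure_ne_top _ _⟩
    suffices h0 : ⋂ k : ℕ, Set.Ioc a (a + 2 * (1 / ((k : ℝ) + 1))) = ∅ by
      rwa [← Set.preimage_iInter, h0, Set.preimage_empty, measure_empty] at this
    rw [Set.eq_empty_iff_forall_notMem]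
    intro x hx
    rw [Set.mem_iInter] at hx
    have hlim : Tendsto (fun k : ℕ => a + 2 * (1 / ((k : ℝ) + 1))) atTop (𝓝 (a + 2 * 0)) :=
      (tendsto_one_div_add_atTop_nhds_zero_nat.const_mul 2).const_add a
    have := ge_of_tendsto' hlim fun k => (hx k).2
    linarith [(hx 0).1]
  obtain ⟨k, hk⟩ := (hstrip.eventually_le_const h2).exists
  set δ : ℝ := 1 / ((k : ℝ) + 1)
  have hδ : 0 < δ := by positivity
  have hN := (tendstoInMeasure_iff_norm.1 h δ hδ).eventually_le_const h2
  filter_upwards [hN] with N hN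
  refine ⟨g N ⁻¹' Set.Ioi (a + δ), hg N measurableSet_Ioi, ?_⟩
  have hsub : (f ⁻¹' Set.Ioi a) ∆ (g N ⁻¹' Set.Ioi (a + δ)) ⊆
      f ⁻¹' Set.Ioc a (a + 2 * δ) ∪ {ω | δ ≤ ‖g N ω - f ω‖} := by
    intro ω hω
    by_contra hcon
    simp only [Set.mem_union, Set.mem_preimage, Set.mem_Ioc, Set.mem_ofPred_eq, not_or, not_and,
      not_le, Real.norm_eq_abs, abs_lt] at hcon
    rcases hω with ⟨h1, h3⟩ | ⟨h1, h3⟩ <;>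
      simp only [Set.mem_preimage, Set.mem_Ioi, not_lt] at h1 h3
    · have := hcon.1 h1
      linarith [hcon.2.1]
    · linarith [hcon.2.2]
  calc P _ ≤ P (f ⁻¹' Set.Ioc a (a + 2 * δ)) + P {ω | δ ≤ ‖g N ω - f ω‖} :=
        (measure_mono hsub).trans (measure_union_le _ _)
    _ ≤ ε := (add_le_add hk hN).trans_eq (ENNReal.add_halves ε)

/-- The conditional expectation is, up to a factor `2`, the best approximation in `L^p`. -/
lemma eLpNorm_condExp_sub_le {m : MeasurableSpace Ω} (hm : m ≤ mΩ) {p : ℝ≥0∞} (hp : 1 ≤ p)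
    {Y Z : Ω → ℝ} (hY : Integrable Y P) (hZ : Integrable Z P)
    (hZm : StronglyMeasurable[m] Z) :
    eLpNorm (P[Y | m] - Y) p P ≤ 2 * eLpNorm (Y - Z) p P := by
  -- Subtracting the `m`-measurable `Z` does not change the error; contractivity of conditional
  -- expectation then bounds each of the two terms.
  have h1 : P[Y | m] - Y =ᵐ[P] P[Y - Z | m] - (Y - Z) := by
    filter_upwards [condExp_sub hY hZ m] with ω hω
    rw [Pi.sub_apply, Pi.sub_apply, hω, Pi.sub_apply, condExp_of_stronglyMeasurable hm hZm hZ,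
      Pi.sub_apply]
    ring
  rw [eLpNorm_congr_ae h1, two_mul]
  exact (eLpNorm_sub_le integrable_condExp.aestronglyMeasurable
    (hY.sub hZ).aestronglyMeasurable hp).trans
    (add_le_add (eLpNorm_condExp_le_eLpNorm _ hp) le_rfl)

/-- Take `c 1_{A'}` with `A'` in `G N` as competitor: its distance from `c 1_A` is `|c| P(A ∆
A')^{1/p}`, small because `p` is finite. -/
lemma tendsto_eLpNorm_condExp_indicator (hG : ∀ N, G N ≤ mΩ) {p : ℝ≥0∞} (hp : 1 ≤ p)
    (hp_top : p ≠ ∞) {A : Set Ω} (hA : MeasurableSet[asymptoticEvents P G] A) (c : ℝ) :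
    Tendsto (fun N => eLpNorm (P[A.indicator (fun _ => c) | G N] - A.indicator (fun _ => c)) p P)
      atTop (𝓝 0) := by
  have hp0 : 0 < p.toReal := ENNReal.toReal_pos (zero_lt_one.trans_le hp).ne' hp_top
  rw [ENNReal.tendsto_nhds_zero]
  intro ε hε
  have hlim : Tendsto (fun δ : ℝ≥0∞ => 2 * (‖c‖ₑ * δ ^ (1 / p.toReal))) (𝓝 0) (𝓝 0) := by
    have h1 : Tendsto (fun δ : ℝ≥0∞ => δ ^ (1 / p.toReal)) (𝓝 0) (𝓝 0) := by
      have := (ENNReal.continuous_rpow_const (y := 1 / p.toReal)).tendsto 0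
      rwa [ENNReal.zero_rpow_of_pos (by positivity)] at this
    have h2 := ENNReal.Tendsto.const_mul h1 (a := ‖c‖ₑ) (.inr enorm_ne_top)
    have h3 := ENNReal.Tendsto.const_mul h2 (a := 2) (.inr (by simp))
    simpa using h3
  obtain ⟨δ, hδ, hδ'⟩ : ∃ δ : ℝ≥0∞, 2 * (‖c‖ₑ * δ ^ (1 / p.toReal)) ≤ ε ∧ 0 < δ := by
    have := (hlim.eventually_le_const hε).filter_mono (nhdsWithin_le_nhds (s := Set.Ioi 0))
    exact (this.and self_mem_nhdsWithin).exists
  filter_upwards [hA.2 δ hδ'] with N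
  rintro ⟨A', hA', hle⟩
  have hint : ∀ S, MeasurableSet S → Integrable (S.indicator fun _ => c) P := fun S hS =>
    (integrable_const c).indicator hS
  calc eLpNorm (P[A.indicator (fun _ => c) | G N] - A.indicator (fun _ => c)) p P
      ≤ 2 * eLpNorm (A.indicator (fun _ => c) - A'.indicator (fun _ => c)) p P :=
        eLpNorm_condExp_sub_le (hG N) hp (hint _ hA.1) (hint _ (hG N _ hA'))
          (stronglyMeasurable_const.indicator hA')
    _ = 2 * (‖c‖ₑ * P (A ∆ A') ^ (1 / p.toReal)) := by
        rw [eLpNorm_indicator_sub_indicator, eLpNorm_indicator_const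
          (hA.1.symmDiff (hG N _ hA')) (zero_lt_one.trans_le hp).ne' hp_top]
    _ ≤ 2 * (‖c‖ₑ * δ ^ (1 / p.toReal)) := by gcongr
    _ ≤ ε := hδ

lemma sigmaAlgebraConvergesLp_of_le_asymptoticEvents (hG : ∀ N, G N ≤ mΩ)
    {G₀ : MeasurableSpace Ω} (h : G₀ ≤ asymptoticEvents P G) {p : ℝ≥0∞} (hp : 1 ≤ p)
    (hp_top : p ≠ ∞) : SigmaAlgebraConvergesLp P p G G₀ where
  indicator A hA := tendsto_eLpNorm_condExp_indicator hG hp hp_top (h A hA) 1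
  memLp Y hY hYp := by
    have : Fact (1 ≤ p) := ⟨hp⟩
    have hG₀ : G₀ ≤ mΩ := fun A hA => (h A hA).1
    refine MemLp.induction_stronglyMeasurable hG₀ hp_top
      (fun Y => Tendsto (fun N => eLpNorm (P[Y | G N] - Y) p P) atTop (𝓝 0)) ?_ ?_ ?_ ?_ hYp
      hY.aestronglyMeasurable
    · intro c s hs _
      exact tendsto_eLpNorm_condExp_indicator hG hp hp_top (h s hs) c
    · intro f g _ hf hg _ _ hf' hg'
      refine tendsto_of_tendsto_of_tendsto_of_le_of_le tendsto_const_nhds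
        (by simpa using hf'.add hg') (fun _ => zero_le) fun N => ?_
      have h1 : P[f + g | G N] - (f + g) =ᵐ[P] (P[f | G N] - f) + (P[g | G N] - g) := by
        filter_upwards [condExp_add (hf.integrable hp) (hg.integrable hp) (G N)] with ω hω
        simp only [Pi.sub_apply, hω, Pi.add_apply]
        ring
      rw [eLpNorm_congr_ae h1]
      exact eLpNorm_add_le (integrable_condExp.aestronglyMeasurable.sub hf.1)
        (integrable_condExp.aestronglyMeasurable.sub hg.1) hp
    -- Closedness in `L^p`: replacing `f` by a nearby `g` costs `‖f - g‖` twice, once for the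
    -- function and once for its conditional expectation, uniformly in `N`.
    · rw [← closure_subset_iff_isClosed]
      intro f hf
      rw [Set.mem_ofPred_eq, ENNReal.tendsto_nhds_zero]
      intro ε hε
      have h3 : 0 < ε / 3 := ENNReal.div_pos hε.ne' (by simp)
      obtain ⟨g, hg, hfg⟩ := EMetric.mem_closure_iff.1 hf _ h3
      have hfg' : eLpNorm ((f : Lp ℝ p P) - (g : Lp ℝ p P) : Ω → ℝ) p P ≤ ε / 3 := by
        rw [← Lp.edist_def]; exact hfg.le
      filter_upwards [hg.eventually_le_const h3] with N hN
      have hfi := (Lp.memLp (f : Lp ℝ p P)).integrable hp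
      have hgi := (Lp.memLp (g : Lp ℝ p P)).integrable hp
      have h1 : P[((f : Lp ℝ p P) : Ω → ℝ) | G N] - ((f : Lp ℝ p P) : Ω → ℝ) =ᵐ[P]
          P[((f : Lp ℝ p P) - (g : Lp ℝ p P) : Ω → ℝ) | G N] -
            ((f : Lp ℝ p P) - (g : Lp ℝ p P) : Ω → ℝ) +
          (P[((g : Lp ℝ p P) : Ω → ℝ) | G N] - ((g : Lp ℝ p P) : Ω → ℝ)) := by
        filter_upwards [condExp_sub hfi hgi (G N)] with ω hω
        simp only [Pi.sub_apply, Pi.add_apply] at hω ⊢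
        rw [hω]
        ring
      rw [eLpNorm_congr_ae h1]
      have hfg_meas := (hfi.sub hgi).aestronglyMeasurable
      calc _ ≤ _ := eLpNorm_add_le (integrable_condExp.aestronglyMeasurable.sub hfg_meas)
            (integrable_condExp.aestronglyMeasurable.sub hgi.aestronglyMeasurable) hp
        _ ≤ (ε / 3 + ε / 3) + ε / 3 := by
            refine add_le_add ((eLpNorm_sub_le integrable_condExp.aestronglyMeasurable
              hfg_meas hp).trans (add_le_add ?_ hfg')) hN
            exact (eLpNorm_condExp_le_eLpNorm _ hp).trans hfg'
        _ = ε := ENNReal.add_thirds ε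
    · intro f g hfg hf hf'
      refine (tendsto_congr fun N => ?_).1 hf'
      exact eLpNorm_congr_ae ((condExp_congr_ae hfg).sub hfg)

end SigmaAlgebras

/-! ### Convergence in probability and in `L²` -/

section ConvergenceInMeasure

/-- A union bound over the coordinates, in the sup norm. A general `E` permits the nested use for
`Fin 3 → Fin d → ℝ`. -/
lemma tendstoInMeasure_pi {Ω ι : Type*} [Fintype ι] {mΩ : MeasurableSpace Ω} {P : Measure Ω}
    {E : Type*} [SeminormedAddCommGroup E] {f : ℕ → Ω → ι → E} {g : Ω → ι → E}
    (h : ∀ i, TendstoInMeasure P (fun N ω => f N ω i) atTop (fun ω => g ω i)) :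
    TendstoInMeasure P f atTop g := by
  rw [tendstoInMeasure_iff_norm]
  intro ε hε
  refine tendsto_of_tendsto_of_tendsto_of_le_of_le tendsto_const_nhds
    (h := fun N => ∑ i, P {ω | ε ≤ ‖f N ω i - g ω i‖}) ?_ (fun _ => zero_le) fun N => ?_
  · simpa using tendsto_finsetSum Finset.univ
      fun i _ => tendstoInMeasure_iff_norm.1 (h i) ε hε
  · refine (measure_mono fun ω hω => ?_).trans (measure_iUnion_fintype_le P _)
    rw [Set.mem_iUnion]
    by_contra! hcon
    simp only [Set.mem_ofPred_eq, not_le] at hω hcon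
    exact not_le.2 ((pi_norm_lt_iff hε).2 hcon) hω

/-- Dominated convergence to `0` in `L²`. -/
lemma tendsto_eLpNorm_two_of_dominated {α : Type*} {mα : MeasurableSpace α} {μ : Measure α}
    {F : ℕ → α → ℝ} {bound : α → ℝ} (hbound : MemLp bound 2 μ)
    (hF : ∀ᶠ N in atTop, AEStronglyMeasurable (F N) μ)
    (hle : ∀ᶠ N in atTop, ∀ᵐ x ∂μ, |F N x| ≤ bound x)
    (hlim : ∀ᵐ x ∂μ, Tendsto (fun N => F N x) atTop (𝓝 0)) :
    Tendsto (fun N => eLpNorm (F N) 2 μ) atTop (𝓝 0) := by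
  have hint : Tendsto (fun N => ∫⁻ x, ‖F N x‖ₑ ^ (2 : ℝ) ∂μ) atTop (𝓝 (∫⁻ _, 0 ∂μ)) := by
    refine tendsto_lintegral_filter_of_dominated_convergence' (fun x => ‖bound x‖ₑ ^ (2 : ℝ)) ?_ ?_
      ?_ ?_
    · exact hF.mono fun N hN => hN.enorm.pow_const _
    · filter_upwards [hle] with N hN
      filter_upwards [hN] with x hx
      gcongr
      rw [enorm_le_iff_norm_le]
      exact hx.trans (le_abs_self _)
    · have := (lintegral_rpow_enorm_lt_top_of_eLpNorm_lt_top (by simp) (by simp) hbound.2).ne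
      simpa using this
    · filter_upwards [hlim] with x hx
      have h1 : Tendsto (fun N => ‖F N x‖ₑ) atTop (𝓝 0) := by simpa using hx.enorm
      have h2 := (ENNReal.continuous_rpow_const (y := 2)).tendsto 0 |>.comp h1
      rwa [ENNReal.zero_rpow_of_pos (by norm_num)] at h2
  have h3 := (ENNReal.continuous_rpow_const (y := 1 / 2)).tendsto _ |>.comp hint
  rw [lintegral_zero, ENNReal.zero_rpow_of_pos (by norm_num)] at h3
  refine h3.congr fun N => ?_
  rw [eLpNorm_eq_lintegral_rpow_enorm_toReal (by simp) (by simp)]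
  simp

end ConvergenceInMeasure

/-! ### Wiener integrals -/

section WienerIntegral

variable {Ω : Type*} {mΩ : MeasurableSpace Ω} {P : Measure Ω} {W : ℝ≥0 → Ω → ℝ}

lemma wienerIntegral_eq (P : Measure Ω) (W : ℝ≥0 → Ω → ℝ) {f : ℝ → ℝ} {a b : ℝ}
    (h : MemLp ((Set.Ioc a b).indicator f) 2 timeMeasure) :
    wienerIntegral W P f a b =
      ((elementaryIntegral W P).extendOfNorm stepFunction (h.toLp _) : Lp ℝ 2 P) :=
  dif_pos h

lemma measurable_wienerIntegral (P : Measure Ω) (W : ℝ≥0 → Ω → ℝ) (f : ℝ → ℝ) (a b : ℝ) :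
    Measurable (wienerIntegral W P f a b) := by
  unfold wienerIntegral
  split_ifs
  · exact (Lp.stronglyMeasurable _).measurable
  · exact measurable_const

lemma norm_extendOfNorm_elementaryIntegral_le (hW : IsPreBrownianReal W P)
    (f : Lp ℝ 2 timeMeasure) :
    ‖(elementaryIntegral W P).extendOfNorm stepFunction f‖ ≤ ‖f‖ := by
  simpa using LinearMap.norm_extendOfNorm_apply_le denseRange_stepFunction 1
    (fun φ => by rw [one_mul, norm_elementaryIntegral hW φ]) f

/-- If linear combinations of indefinite integrands converge in `L²(0, ∞)`, then the linear
combinations of the Wiener integrals converge in probability. -/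
lemma tendstoInMeasure_sum_wienerIntegral (hW : IsPreBrownianReal W P) {ι : Type*}
    {s : ℕ → Finset ι} {c a b : ℕ → ι → ℝ} {f g : ℝ → ℝ} {α β : ℝ}
    (hf : ∀ᶠ N in atTop, ∀ n ∈ s N, MemLp ((Set.Ioc (a N n) (b N n)).indicator f) 2 timeMeasure)
    (hg : MemLp ((Set.Ioc α β).indicator g) 2 timeMeasure)
    (h : Tendsto (fun N => eLpNorm (fun u =>
      ∑ n ∈ s N, c N n * (Set.Ioc (a N n) (b N n)).indicator f u - (Set.Ioc α β).indicator g u) 2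
      timeMeasure) atTop (𝓝 0)) :
    TendstoInMeasure P (fun N ω => ∑ n ∈ s N, c N n * wienerIntegral W P f (a N n) (b N n) ω)
      atTop (wienerIntegral W P g α β) := by
  set T := (elementaryIntegral W P).extendOfNorm stepFunction
  have hsum : ∀ N, (∀ n ∈ s N, MemLp ((Set.Ioc (a N n) (b N n)).indicator f) 2 timeMeasure) →
      eLpNorm ((fun ω => ∑ n ∈ s N, c N n * wienerIntegral W P f (a N n) (b N n) ω) -
        wienerIntegral W P g α β) 2 P ≤ eLpNorm (fun u =>
      ∑ n ∈ s N, c N n * (Set.Ioc (a N n) (b N n)).indicator f u - (Set.Ioc α β).indicator g u) 2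
      timeMeasure := by
    intro N hN
    -- By linearity the error of the integrals is the integral of the error `x`, so contractivity
    -- compares the two `L²` norms.
    set x : Lp ℝ 2 timeMeasure := ∑ n ∈ (s N).attach, c N n • (hN n n.2).toLp _ - hg.toLp _
    have hx : x =ᵐ[timeMeasure] fun u => ∑ n ∈ s N,
        c N n * (Set.Ioc (a N n) (b N n)).indicator f u - (Set.Ioc α β).indicator g u := by
      have h1 : ∀ n : s N, (c N n • (hN n n.2).toLp _ : Lp ℝ 2 timeMeasure) =ᵐ[timeMeasure]
          fun u => c N n * (Set.Ioc (a N n) (b N n)).indicator f u := by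
        intro n
        filter_upwards [Lp.coeFn_smul (c N n) ((hN n n.2).toLp _), (hN n n.2).coeFn_toLp]
          with u h2 h3
        rw [h2, Pi.smul_apply, h3, smul_eq_mul]
      filter_upwards [Lp.coeFn_sub (∑ n ∈ (s N).attach, c N n • (hN n n.2).toLp _) (hg.toLp _),
        Lp.coeFn_finsetSum (s N).attach fun n : s N => c N n • (hN n n.2).toLp _,
        hg.coeFn_toLp, ae_all_iff.2 h1] with u h2 h3 h4 h5
      rw [h2, Pi.sub_apply, h3, h4, Finset.sum_apply, ← Finset.sum_attach (s N)]
      simp only [h5]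
    have hTx : T x =ᵐ[P] (fun ω => ∑ n ∈ s N, c N n * wienerIntegral W P f (a N n) (b N n) ω) -
        wienerIntegral W P g α β := by
      have h1 : ∀ n : s N, (c N n • T ((hN n n.2).toLp _) : Lp ℝ 2 P) =ᵐ[P]
          fun ω => c N n * wienerIntegral W P f (a N n) (b N n) ω := by
        intro n
        filter_upwards [Lp.coeFn_smul (c N n) (T ((hN n n.2).toLp _))] with u h2
        rw [h2, Pi.smul_apply, wienerIntegral_eq P W (hN n n.2), smul_eq_mul]
      have h0 : T x = ∑ n ∈ (s N).attach, c N n • T ((hN n n.2).toLp _) - T (hg.toLp _) := by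
        simp only [x, map_sub, map_sum, map_smul]
      rw [h0]
      filter_upwards [Lp.coeFn_sub (∑ n ∈ (s N).attach, c N n • T ((hN n n.2).toLp _))
          (T (hg.toLp _)),
        Lp.coeFn_finsetSum (s N).attach fun n : s N => c N n • T ((hN n n.2).toLp _),
        ae_all_iff.2 h1] with u h2 h3 h5
      rw [h2, Pi.sub_apply, h3, Finset.sum_apply, Pi.sub_apply, wienerIntegral_eq P W hg,
        ← Finset.sum_attach (s N)]
      simp only [h5]
      rfl
    rw [← eLpNorm_congr_ae hTx, ← eLpNorm_congr_ae hx, ← Lp.enorm_def, ← Lp.enorm_def,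
      enorm_le_iff_norm_le]
    exact norm_extendOfNorm_elementaryIntegral_le hW x
  refine tendstoInMeasure_of_tendsto_eLpNorm (p := 2) (by simp) (fun N => ?_)
    (measurable_wienerIntegral P W g α β).aestronglyMeasurable ?_
  · exact (Finset.measurable_fun_sum _ fun n _ =>
      (measurable_wienerIntegral P W f _ _).const_mul _).aestronglyMeasurable
  · exact tendsto_of_tendsto_of_tendsto_of_le_of_le' tendsto_const_nhds h
      (.of_forall fun _ => zero_le) (hf.mono hsum)

lemma memLp_indicator_Ioc {f : ℝ → ℝ} {a b : ℝ} (hf : ContinuousOn f (Set.Icc a b)) :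
    MemLp ((Set.Ioc a b).indicator f) 2 timeMeasure := by
  refine MemLp.restrict _ ((memLp_indicator_iff_restrict measurableSet_Ioc).2 ?_)
  obtain ⟨K, hK⟩ := isCompact_Icc.exists_bound_of_continuousOn hf
  refine MemLp.of_bound ((hf.mono Set.Ioc_subset_Icc_self).aestronglyMeasurable measurableSet_Ioc) K
    ?_
  exact (ae_restrict_iff' measurableSet_Ioc).2
    (.of_forall fun x hx => hK x (Set.Ioc_subset_Icc_self hx))

/-- Identifies the limit when the convergence lemma above is applied with integrand `g = 0` to
noises that vanish. -/
lemma wienerIntegral_zero_ae (P : Measure Ω) (W : ℝ≥0 → Ω → ℝ) (a b : ℝ) :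
    wienerIntegral W P 0 a b =ᵐ[P] 0 := by
  have h : MemLp ((Set.Ioc a b).indicator 0) 2 timeMeasure :=
    memLp_indicator_Ioc (continuousOn_const (c := (0 : ℝ)))
  rw [wienerIntegral_eq P W h]
  have h0 : h.toLp _ = 0 := by
    rw [Lp.eq_zero_iff_ae_eq_zero]
    exact h.coeFn_toLp.trans (.of_eq (Set.indicator_zero' _))
  rw [h0, map_zero]
  exact Lp.coeFn_zero _ _ _

/-- The Wiener integral of `1` over `(a, b]` is the increment. -/
lemma wienerIntegral_one_ae (hW : IsPreBrownianReal W P) {a b : ℝ≥0} (hab : a ≤ b) :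
    wienerIntegral W P 1 a b =ᵐ[P] W b - W a := by
  have : IsProbabilityMeasure P := hW.isGaussianProcess.isProbabilityMeasure
  have hm : ∀ t, MemLp (W t) 2 P := fun t => (hW.isGaussianProcess.hasGaussianLaw_eval t).memLp_two
  have h : MemLp ((Set.Ioc (a : ℝ) b).indicator 1) 2 timeMeasure :=
    memLp_indicator_Ioc (continuousOn_const (c := (1 : ℝ)))
  -- On `(0, ∞)`, `1_(a, b] = 1_(0, b] - 1_(0, a]`, so the integral is an elementary one.
  have h1 : h.toLp _ = stepFunction (Finsupp.single b 1 - Finsupp.single a 1) := by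
    rw [map_sub, stepFunction_single, stepFunction_single, indicatorConstLp, indicatorConstLp,
      ← MemLp.toLp_sub, MemLp.toLp_eq_toLp_iff]
    refine ae_restrict_of_forall_mem measurableSet_Ioi fun u hu => ?_
    have hab' : (a : ℝ) ≤ b := hab
    simp only [Set.indicator_apply, Pi.sub_apply, Set.mem_Ioc, Pi.one_apply]
    have hu' : 0 < u := hu
    split_ifs <;> grind
  rw [wienerIntegral_eq P W h, h1, LinearMap.extendOfNorm_eq denseRange_stepFunction
    ⟨1, fun φ => by rw [one_mul, norm_elementaryIntegral hW φ]⟩]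
  have h2 : elementaryIntegral W P (Finsupp.single b 1 - Finsupp.single a 1) =
      (hm b).toLp _ - (hm a).toLp _ := by
    simp [elementaryIntegral, hm]
  rw [h2]
  filter_upwards [Lp.coeFn_sub ((hm b).toLp _) ((hm a).toLp _), (hm b).coeFn_toLp,
    (hm a).coeFn_toLp] with ω h3 h4 h5
  rw [h3, Pi.sub_apply, h4, h5, Pi.sub_apply]

end WienerIntegral

/-! ### Dyadic step functions and Riemann sums -/

section StepSums

lemma dyadic_one (N : ℕ) : dyadic N 1 = 0 := by simp [dyadic]

/-- The indices `n ≥ 2` with `dyadic N n ≤ q`. -/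
noncomputable def dyadicIndices (N : ℕ) (q : ℝ) : Finset ℕ := Finset.Icc 2 (⌊q * 2 ^ N⌋₊ + 1)

variable {N n : ℕ} {q : ℝ}

lemma dyadic_pos_of_mem (hn : n ∈ dyadicIndices N q) : 0 < dyadic N n := by
  have h2 : (2 : ℝ) ≤ n := by exact_mod_cast (Finset.mem_Icc.1 hn).1
  exact div_pos (by linarith) (by positivity)

lemma dyadic_le_of_mem (hq : 0 ≤ q) (hn : n ∈ dyadicIndices N q) : dyadic N n ≤ q := by
  have h1 : (n : ℝ) ≤ ⌊q * 2 ^ N⌋₊ + 1 := by exact_mod_cast (Finset.mem_Icc.1 hn).2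
  have h2 := Nat.floor_le (a := q * 2 ^ N) (by positivity)
  rw [dyadic, div_le_iff₀ (by positivity)]
  linarith

lemma le_two_pow_of_mem (hq : 0 ≤ q) (hq1 : q < 1) (hn : n ∈ dyadicIndices N q) : n ≤ 2 ^ N := by
  have h1 : ⌊q * 2 ^ N⌋₊ < 2 ^ N := by
    rw [Nat.floor_lt (by positivity)]
    push_cast
    exact mul_lt_of_lt_one_left (by positivity) hq1
  have := (Finset.mem_Icc.1 hn).2
  lia

lemma dyadic_succ (N n : ℕ) : dyadic N (n + 1) = dyadic N n + (1 / 2) ^ N := by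
  simp only [dyadic, one_div, inv_pow]
  push_cast
  field_simp
  ring

lemma dyadic_mem_Ico_of_mem (hq : 0 ≤ q) (hq1 : q < 1) (hn : n ∈ dyadicIndices N q) :
    dyadic N n ∈ Set.Ico (0 : ℝ) 1 :=
  ⟨(dyadic_pos_of_mem hn).le, (dyadic_le_of_mem hq hn).trans_lt hq1⟩

/-- Only the interval which contains `u` contributes. -/
lemma sum_indicator_dyadic (s : Finset ℕ) (hs : ∀ n ∈ s, 1 ≤ n) (c : ℕ → ℝ) (f : ℝ → ℝ) (u : ℝ) :
    ∑ n ∈ s, c n * (Set.Ioc (dyadic N n) (dyadic N (n + 1))).indicator f u =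
      if ⌈u * 2 ^ N⌉₊ ∈ s then c ⌈u * 2 ^ N⌉₊ * f u else 0 := by
  rw [← Finset.sum_ite_eq s ⌈u * 2 ^ N⌉₊ fun n => c n * f u]
  refine Finset.sum_congr rfl fun n hn => ?_
  have hn1 := hs n hn
  -- Membership says `n - 1 < u 2^N ≤ n`. The natural ceiling sends all `u ≤ 0` to `0`, which `1 ≤
  -- n` rules out.
  have hiff : u ∈ Set.Ioc (dyadic N n) (dyadic N (n + 1)) ↔ ⌈u * 2 ^ N⌉₊ = n := by
    rw [Nat.ceil_eq_iff (by lia), Set.mem_Ioc, dyadic, dyadic, div_lt_iff₀ (by positivity),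
      le_div_iff₀ (by positivity)]
    push_cast [Nat.cast_sub hn1]
    rw [add_sub_cancel_right]
  rw [Set.indicator_apply]
  simp only [hiff]
  split_ifs <;> simp

lemma eventually_dyadic_succ_le {q c : ℝ} (hq : 0 ≤ q) (hqc : q < c) :
    ∀ᶠ N in atTop, ∀ n ∈ dyadicIndices N q, dyadic N (n + 1) ≤ c := by
  have h1 : Tendsto (fun N : ℕ => q + (1 / 2 : ℝ) ^ N) atTop (𝓝 (q + 0)) :=
    (tendsto_pow_atTop_nhds_zero_of_lt_one (by norm_num) (by norm_num)).const_add q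
  filter_upwards [h1.eventually_le_const (by simpa using hqc)] with N hN n hn
  rw [dyadic_succ]
  linarith [dyadic_le_of_mem hq hn]

/-- `f` is controlled only on compact subintervals of `[0, 1)`, and the last dyadic interval may
overshoot `q` by `2^{-N}`; for large `N` all of them stay below a fixed `c < 1`. -/
lemma eventually_memLp_indicator_dyadic {f : ℝ → ℝ} (hf : ContinuousOn f (Set.Ico 0 1))
    (hq : 0 ≤ q) (hq1 : q < 1) : ∀ᶠ N in atTop, ∀ n ∈ dyadicIndices N q,
      MemLp ((Set.Ioc (dyadic N n) (dyadic N (n + 1))).indicator f) 2 timeMeasure := by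
  obtain ⟨c, hqc, hc⟩ := exists_between hq1
  filter_upwards [eventually_dyadic_succ_le hq hqc] with N hN n hn
  exact memLp_indicator_Ioc (hf.mono fun x hx =>
    ⟨(dyadic_pos_of_mem hn).le.trans hx.1, (hx.2.trans (hN n hn)).trans_lt hc⟩)

/-- At most one summand is nonzero at `u`, and `φ`, `f` are bounded on `[0, c]`. The majorant does
not depend on `N` and serves dominated convergence both in `L²` and for Riemann sums. -/
lemma eventually_abs_stepSum_le {φ f : ℝ → ℝ} (hφ : ContinuousOn φ (Set.Ico 0 1))
    (hf : ContinuousOn f (Set.Ico 0 1)) (hq : 0 ≤ q) {c : ℝ} (hqc : q < c) (hc : c < 1) :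
    ∃ K, 0 ≤ K ∧ ∀ᶠ N in atTop, ∀ u, |∑ n ∈ dyadicIndices N q, φ (dyadic N n) *
      (Set.Ioc (dyadic N n) (dyadic N (n + 1))).indicator f u| ≤
        (Set.Ioc 0 c).indicator (fun _ => K) u := by
  have hsub : Set.Icc 0 c ⊆ Set.Ico (0 : ℝ) 1 := fun x hx => ⟨hx.1, hx.2.trans_lt hc⟩
  obtain ⟨K₁, hK₁⟩ := isCompact_Icc.exists_bound_of_continuousOn (hφ.mono hsub)
  obtain ⟨K₂, hK₂⟩ := isCompact_Icc.exists_bound_of_continuousOn (hf.mono hsub)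
  have hK₁0 : 0 ≤ K₁ := (norm_nonneg _).trans (hK₁ 0 ⟨le_rfl, hq.trans hqc.le⟩)
  have hK₂0 : 0 ≤ K₂ := (norm_nonneg _).trans (hK₂ 0 ⟨le_rfl, hq.trans hqc.le⟩)
  refine ⟨K₁ * K₂, mul_nonneg hK₁0 hK₂0, ?_⟩
  filter_upwards [eventually_dyadic_succ_le hq hqc] with N hN u
  rw [sum_indicator_dyadic _ fun n hn => by linarith [(Finset.mem_Icc.1 hn).1]]
  split_ifs with hmem
  · set n := ⌈u * 2 ^ N⌉₊ with hn
    have hpos : (0 : ℝ) < 2 ^ N := by positivity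
    have hu0 : 0 < u := by
      have : 0 < ⌈u * 2 ^ N⌉₊ := by have := (Finset.mem_Icc.1 hmem).1; lia
      exact pos_of_mul_pos_left (Nat.ceil_pos.1 this) hpos.le
    have huc : u ≤ c := by
      refine le_trans ?_ (hN n hmem)
      rw [dyadic, le_div_iff₀ hpos]
      push_cast
      linarith [Nat.le_ceil (u * 2 ^ N)]
    rw [Set.indicator_of_mem (by exact ⟨hu0, huc⟩), abs_mul]
    exact mul_le_mul (hK₁ _ ⟨(dyadic_pos_of_mem hmem).le, (dyadic_le_of_mem hq hmem).trans hqc.le⟩)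
      (hK₂ u ⟨hu0.le, huc⟩) (abs_nonneg _) hK₁0
  · rw [abs_zero]
    exact Set.indicator_nonneg (fun _ _ => mul_nonneg hK₁0 hK₂0) _

/-- The surviving node is the left endpoint of the dyadic interval around `u`, within `2^{-N}` of
`u`, so continuity of `φ` suffices. The excluded point `q` is null. -/
lemma tendsto_stepSum {φ : ℝ → ℝ} (hφ : ContinuousOn φ (Set.Ico 0 1)) (f : ℝ → ℝ)
    (hq : 0 ≤ q) (hq1 : q < 1) {u : ℝ} (hu : u ≠ q) :
    Tendsto (fun N => ∑ n ∈ dyadicIndices N q, φ (dyadic N n) *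
      (Set.Ioc (dyadic N n) (dyadic N (n + 1))).indicator f u) atTop
      (𝓝 ((Set.Ioc 0 q).indicator (fun u => φ u * f u) u)) := by
  simp only [fun N : ℕ => sum_indicator_dyadic (N := N) (dyadicIndices N q)
    (fun n hn => by linarith [(Finset.mem_Icc.1 hn).1]) (fun n => φ (dyadic N n)) f u]
  have hpow : Tendsto (fun N : ℕ => (2 : ℝ) ^ N) atTop atTop :=
    tendsto_pow_atTop_atTop_of_one_lt (by norm_num)
  rcases le_or_gt u 0 with hu0 | hu0
  · rw [Set.indicator_of_notMem (by simp [hu0])]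
    refine tendsto_const_nhds.congr fun N => ?_
    rw [if_neg]
    rw [Nat.ceil_eq_zero.2 (mul_nonpos_of_nonpos_of_nonneg hu0 (by positivity))]
    simp [dyadicIndices]
  rcases hu.lt_or_gt with huq | huq
  · rw [Set.indicator_of_mem (by exact ⟨hu0, huq.le⟩)]
    have hmem : ∀ᶠ N in atTop, ⌈u * 2 ^ N⌉₊ ∈ dyadicIndices N q := by
      -- The indices start at `2`, so `u` must have left the first interval: `u 2^N > 1`.
      filter_upwards [(hpow.const_mul_atTop hu0).eventually_gt_atTop 1] with N hN
      rw [dyadicIndices, Finset.mem_Icc]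
      constructor
      · have : 1 < ⌈u * 2 ^ N⌉₊ := Nat.lt_ceil.2 (by simpa using hN)
        exact this
      · exact (Nat.ceil_mono (by gcongr)).trans (Nat.ceil_le_floor_add_one _)
    have hdy : Tendsto (fun N : ℕ => dyadic N ⌈u * 2 ^ N⌉₊) atTop (𝓝[Set.Ico 0 1] u) := by
      refine tendsto_nhdsWithin_iff.2 ⟨?_, ?_⟩
      · have h1 : Tendsto (fun N : ℕ => u - (1 / 2 : ℝ) ^ N) atTop (𝓝 (u - 0)) :=
          (tendsto_pow_atTop_nhds_zero_of_lt_one (by norm_num) (by norm_num)).const_sub u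
        rw [sub_zero] at h1
        refine tendsto_of_tendsto_of_tendsto_of_le_of_le h1 tendsto_const_nhds (fun N => ?_)
          fun N => ?_
        · have := Nat.le_ceil (u * 2 ^ N)
          simp only [dyadic]
          rw [le_div_iff₀ (by positivity), sub_mul, ← mul_pow]
          norm_num
          linarith
        · have := Nat.ceil_lt_add_one (a := u * 2 ^ N) (by positivity)
          simp only [dyadic]
          rw [div_le_iff₀ (by positivity)]
          linarith
      · filter_upwards [hmem] with N hN
        exact dyadic_mem_Ico_of_mem hq hq1 hN
    have hlim := ((hφ u ⟨hu0.le, huq.trans hq1⟩).tendsto.comp hdy).mul_const (f u)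
    refine hlim.congr' ?_
    filter_upwards [hmem] with N hN
    rw [if_pos hN, Function.comp_apply]
  · rw [Set.indicator_of_notMem (by simp [huq])]
    refine tendsto_const_nhds.congr' ?_
    -- Once `2^{-N} < u - q`, no interval starting at or before `q` reaches `u`.
    filter_upwards [(hpow.const_mul_atTop (sub_pos.2 huq)).eventually_gt_atTop 1] with N hN
    rw [if_neg]
    intro hmem
    have h1 := dyadic_le_of_mem hq hmem
    rw [dyadic, div_le_iff₀ (by positivity)] at h1
    have := Nat.le_ceil (u * 2 ^ N)
    linarith

lemma ae_timeMeasure_ne (q : ℝ) : ∀ᵐ u ∂timeMeasure, u ≠ q :=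
  ae_restrict_of_ae (compl_mem_ae_iff.2 (measure_singleton q))

/-- The step sums converge in `L²(0, ∞)`. -/
lemma tendsto_eLpNorm_stepSum_sub {φ f g : ℝ → ℝ} (hφ : ContinuousOn φ (Set.Ico 0 1))
    (hf : ContinuousOn f (Set.Ico 0 1)) (hq : 0 ≤ q) (hq1 : q < 1)
    (hg : ∀ u ∈ Set.Ico (0 : ℝ) 1, g u = φ u * f u) :
    Tendsto (fun N => eLpNorm (fun u => ∑ n ∈ dyadicIndices N q, φ (dyadic N n) *
      (Set.Ioc (dyadic N n) (dyadic N (n + 1))).indicator f u - (Set.Ioc 0 q).indicator g u) 2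
      timeMeasure) atTop (𝓝 0) := by
  obtain ⟨c, hqc, hc⟩ := exists_between hq1
  obtain ⟨K, hK0, hK⟩ := eventually_abs_stepSum_le hφ hf hq hqc hc
  have hind : (Set.Ioc 0 q).indicator g = (Set.Ioc 0 q).indicator fun u => φ u * f u :=
    Set.indicator_congr fun u hu => hg u ⟨hu.1.le, hu.2.trans_lt hq1⟩
  have hgm : MemLp ((Set.Ioc 0 q).indicator g) 2 timeMeasure := by
    rw [hind]
    exact memLp_indicator_Ioc ((hφ.mul hf).mono fun x hx => ⟨hx.1, hx.2.trans_lt hq1⟩)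
  have hbound : MemLp ((Set.Ioc 0 c).indicator fun _ => K) 2 timeMeasure :=
    memLp_indicator_Ioc continuousOn_const
  refine tendsto_eLpNorm_two_of_dominated (hbound.add hgm.norm) ?_ ?_ ?_
  · filter_upwards [eventually_memLp_indicator_dyadic hf hq hq1] with N hN
    refine AEStronglyMeasurable.sub (Finset.aestronglyMeasurable_fun_sum _ fun n hn => ?_) hgm.1
    exact (hN n hn).1.const_mul _
  · filter_upwards [hK] with N hN
    refine .of_forall fun u => ?_
    exact (abs_sub _ _).trans (add_le_add (hN u) le_rfl)
  · filter_upwards [ae_timeMeasure_ne q] with u hu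
    have := (tendsto_stepSum hφ f hq hq1 hu).sub_const ((Set.Ioc 0 q).indicator g u)
    rw [← hind, sub_self] at this
    exact this

/-- Convergence of the left Riemann sums over the dyadic partition. -/
lemma tendsto_dyadic_sum {φ : ℝ → ℝ} (hφ : ContinuousOn φ (Set.Ico 0 1)) (hq : 0 ≤ q)
    (hq1 : q < 1) :
    Tendsto (fun N => ∑ n ∈ dyadicIndices N q, φ (dyadic N n) * (1 / 2) ^ N) atTop
      (𝓝 (∫ u in (0 : ℝ)..q, φ u)) := by
  obtain ⟨c, hqc, hc⟩ := exists_between hq1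
  have h1 : ContinuousOn (fun _ : ℝ => (1 : ℝ)) (Set.Ico 0 1) := continuousOn_const
  obtain ⟨K, hK0, hK⟩ := eventually_abs_stepSum_le hφ h1 hq hqc hc
  have hint : ∀ N n : ℕ, Integrable
      ((Set.Ioc (dyadic N n) (dyadic N (n + 1))).indicator fun _ => (1 : ℝ)) volume := fun N n =>
    (integrable_indicator_iff measurableSet_Ioc).2 (integrableOn_const measure_Ioc_lt_top.ne)
  -- The Riemann sum is the integral of the step sum with `f = 1`; the missing first interval and
  -- the overshoot past `q` disappear in the pointwise limit.
  have key := tendsto_integral_filter_of_dominated_convergence (μ := volume) (l := atTop)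
    (F := fun N u => ∑ n ∈ dyadicIndices N q, φ (dyadic N n) *
      (Set.Ioc (dyadic N n) (dyadic N (n + 1))).indicator (fun _ => (1 : ℝ)) u)
    (f := (Set.Ioc 0 q).indicator fun u => φ u * 1)
    ((Set.Ioc 0 c).indicator fun _ => K)
    (.of_forall fun N => (integrable_finsetSum _ fun n _ =>
      (hint N n).const_mul _).aestronglyMeasurable)
    (hK.mono fun N hN => .of_forall hN)
    ((integrable_indicator_iff measurableSet_Ioc).2 (integrableOn_const measure_Ioc_lt_top.ne))
    (by
      filter_upwards [compl_mem_ae_iff.2 (measure_singleton (μ := volume) q)] with u hu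
      exact tendsto_stepSum hφ _ hq hq1 hu)
  rw [integral_indicator measurableSet_Ioc, ← intervalIntegral.integral_of_le hq] at key
  simp only [mul_one] at key
  refine key.congr fun N => ?_
  rw [integral_finsetSum _ fun n _ => (hint N n).const_mul _]
  refine Finset.sum_congr rfl fun n _ => ?_
  rw [integral_const_mul, integral_indicator measurableSet_Ioc, setIntegral_const,
    Real.volume_real_Ioc_of_le (by rw [dyadic_succ]; simp), dyadic_succ]
  simp

/-- Weighted sums over distinct unit intervals, with weights of order `2^{-N}`, are of order
`2^{-N/2}` in `L²(0, ∞)`. -/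
lemma tendsto_eLpNorm_unit_sum {s : ℕ → Finset ℕ} {c : ℕ → ℕ → ℝ} {K : ℝ}
    (hs : ∀ N, ∀ n ∈ s N, 1 ≤ n ∧ n ≤ 2 ^ N)
    (hc : ∀ N, ∀ n ∈ s N, |c N n| ≤ K * (1 / 2) ^ N) :
    Tendsto (fun N => eLpNorm (fun u => ∑ n ∈ s N, c N n *
      (Set.Ioc ((n - 1 : ℕ) : ℝ) n).indicator 1 u) 2 timeMeasure) atTop (𝓝 0) := by
  have hle : ∀ N, eLpNorm (fun u => ∑ n ∈ s N, c N n *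
      (Set.Ioc ((n - 1 : ℕ) : ℝ) n).indicator 1 u) 2 timeMeasure ≤
        ‖K‖ₑ * (ENNReal.ofReal (1 / 2 : ℝ)) ^ ((N : ℝ) / 2) := by
    intro N
    -- The unit intervals are disjoint inside `(0, 2^N]`, so the sum is at most `K 2^{-N}` on a set
    -- of measure at most `2^N`.
    have hpt : ∀ u, ‖∑ n ∈ s N, c N n * (Set.Ioc ((n - 1 : ℕ) : ℝ) n).indicator 1 u‖ ≤
        ‖(Set.Ioc (0 : ℝ) (2 ^ N)).indicator (fun _ => K * (1 / 2) ^ N) u‖ := by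
      intro u
      have hsum : ∑ n ∈ s N, c N n * (Set.Ioc ((n - 1 : ℕ) : ℝ) n).indicator 1 u =
          if ⌈u⌉₊ ∈ s N then c N ⌈u⌉₊ else 0 := by
        rw [← Finset.sum_ite_eq (s N) ⌈u⌉₊ fun n => c N n]
        refine Finset.sum_congr rfl fun n hn => ?_
        have hiff : u ∈ Set.Ioc ((n - 1 : ℕ) : ℝ) n ↔ ⌈u⌉₊ = n := by
          rw [Nat.ceil_eq_iff (by have := (hs N n hn).1; lia), Set.mem_Ioc]
        rw [Set.indicator_apply]
        simp only [hiff]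
        split_ifs <;> simp
      rw [hsum]
      split_ifs with hmem
      · obtain ⟨h1, h2⟩ := hs N _ hmem
        rw [Set.indicator_of_mem]
        · exact (hc N _ hmem).trans (le_abs_self _)
        · exact ⟨Nat.ceil_pos.1 h1, (Nat.le_ceil u).trans (by exact_mod_cast h2)⟩
      · simp
    refine (eLpNorm_mono hpt).trans ?_
    rw [eLpNorm_indicator_const measurableSet_Ioc (by simp) (by simp), enorm_mul, mul_assoc]
    gcongr
    have h2 : timeMeasure (Set.Ioc (0 : ℝ) (2 ^ N)) ≤ ENNReal.ofReal (2 ^ N) :=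
      (Measure.restrict_apply_le _ _).trans_eq (by simp)
    have h3 : ‖(1 / 2 : ℝ) ^ N‖ₑ = ENNReal.ofReal ((1 / 2) ^ N) :=
      Real.enorm_of_nonneg (by positivity)
    calc _ ≤ ENNReal.ofReal ((1 / 2) ^ N) * ENNReal.ofReal (2 ^ N) ^ (1 / (2 : ℝ≥0∞).toReal) := by
          rw [h3]; gcongr
      _ = ENNReal.ofReal ((1 / 2) ^ N * (2 ^ N) ^ (1 / 2 : ℝ)) := by
          rw [ENNReal.ofReal_rpow_of_pos (by positivity), ← ENNReal.ofReal_mul (by positivity)]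
          simp
      _ = ENNReal.ofReal ((1 / 2) ^ ((N : ℝ) / 2)) := by
          congr 1
          rw [← Real.rpow_natCast, ← Real.rpow_natCast, one_div,
            Real.inv_rpow (by norm_num), Real.inv_rpow (by norm_num), ← Real.rpow_mul (by norm_num),
            ← Real.rpow_neg (by norm_num), ← Real.rpow_neg (by norm_num),
            ← Real.rpow_add (by norm_num)]
          congr 1
          ring
      _ = _ := by rw [ENNReal.ofReal_rpow_of_pos (by norm_num)]
  refine tendsto_of_tendsto_of_tendsto_of_le_of_le tendsto_const_nhds ?_ (fun _ => zero_le) hle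
  have h1 : Tendsto (fun N : ℕ => ENNReal.ofReal (1 / 2) ^ ((N : ℝ) / 2)) atTop (𝓝 0) := by
    have := (tendsto_rpow_atTop_of_base_lt_one (1 / 2 : ℝ) (by norm_num) (by norm_num)).comp
      (tendsto_natCast_atTop_atTop.atTop_div_const (r := (2 : ℝ)) (by norm_num))
    have := ENNReal.tendsto_ofReal this
    rw [ENNReal.ofReal_zero] at this
    refine this.congr fun N => ?_
    rw [ENNReal.ofReal_rpow_of_pos (by norm_num)]
    rfl
  simpa using ENNReal.Tendsto.const_mul h1 (a := ‖K‖ₑ) (.inr enorm_ne_top)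

end StepSums

/-! ### Matrix identities for weighted signals -/

section Matrices

variable {d : ℕ} {C D : Matrix (Fin d) (Fin d) ℝ}

@[fun_prop]
lemma measurable_mulVec {Ω : Type*} {m : MeasurableSpace Ω} (A : Matrix (Fin d) (Fin d) ℝ)
    {f : Ω → Fin d → ℝ} (hf : Measurable f) : Measurable fun ω => A.mulVec (f ω) :=
  (continuous_const.matrix_mulVec continuous_id).measurable.comp hf

open scoped MatrixOrder in
lemma matSqrt_mul_self (hC : C.PosDef) : matSqrt C * matSqrt C = C :=
  CFC.sqrt_mul_sqrt_self C hC.posSemidef.nonneg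

lemma isUnit_det_matSqrt (hC : C.PosDef) : IsUnit (matSqrt C).det := by
  have h := (Matrix.isUnit_iff_isUnit_det _).1 hC.isUnit
  rw [← matSqrt_mul_self hC, Matrix.det_mul] at h
  exact isUnit_of_mul_isUnit_left h

lemma mul_inv_matSqrt (hC : C.PosDef) : C * (matSqrt C)⁻¹ = matSqrt C := by
  nth_rewrite 1 [← matSqrt_mul_self hC]
  exact Matrix.mul_nonsing_inv_cancel_right _ _ (isUnit_det_matSqrt hC)

lemma inv_smul_of_posDef (hC : C.PosDef) {p : ℝ} (hp : p ≠ 0) : (p • C)⁻¹ = p⁻¹ • C⁻¹ :=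
  Matrix.inv_smul' C (Units.mk0 p hp) ((Matrix.isUnit_iff_isUnit_det _).1 hC.isUnit)

lemma smul_mulVec_signal_first (hC : C.PosDef) {p α : ℝ} (hp : 0 < p) (x y z : Fin d → ℝ) :
    (p • C).mulVec (x + (√p)⁻¹ • ((matSqrt C)⁻¹).mulVec y +
      α⁻¹ • ((p • C)⁻¹).mulVec (((matSqrt D)⁻¹).mulVec z)) =
    (p • C).mulVec x + √p • (matSqrt C).mulVec y + α⁻¹ • ((matSqrt D)⁻¹).mulVec z := by
  have hCu := (Matrix.isUnit_iff_isUnit_det _).1 hC.isUnit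
  have hsq : p * (√p)⁻¹ = √p := by
    have := Real.mul_self_sqrt hp.le
    have h0 := (Real.sqrt_pos.2 hp).ne'
    field_simp
    linarith
  simp only [Matrix.mulVec_add, Matrix.mulVec_smul, Matrix.mulVec_mulVec]
  congr 1
  · congr 1
    rw [Matrix.smul_mul, mul_inv_matSqrt hC, Matrix.smul_mulVec, smul_smul, mul_comm, hsq]
  · rw [inv_smul_of_posDef hC hp.ne', Matrix.smul_mul, Matrix.smul_mul, Matrix.mul_smul, smul_smul,
      mul_inv_cancel₀ hp.ne', one_smul, Matrix.mul_nonsing_inv_cancel_left _ _ hCu]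

/-- The weight is chosen so that `α`, `p` and one factor `C` cancel in the demand noise, leaving `a
C D^{1/2} z`. The free scalar `a` will be `λ/τ'` at the node. -/
lemma smul_mulVec_signal (hC : C.PosDef) (hD : D.PosDef) {p α : ℝ} (hp : 0 < p) (hα : α ≠ 0)
    (a : ℝ) (x y z : Fin d → ℝ) :
    (a * α * p) • (C * D * C).mulVec (x + (√p)⁻¹ • ((matSqrt C)⁻¹).mulVec y +
      α⁻¹ • ((p • C)⁻¹).mulVec (((matSqrt D)⁻¹).mulVec z)) =
    (a * α * p) • (C * D * C).mulVec x + (C * D * matSqrt C).mulVec ((a * α * √p) • y) +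
      (C * matSqrt D).mulVec (a • z) := by
  have hCu := (Matrix.isUnit_iff_isUnit_det _).1 hC.isUnit
  have hsq : p * (√p)⁻¹ = √p := by
    have := Real.mul_self_sqrt hp.le
    have h0 := (Real.sqrt_pos.2 hp).ne'
    field_simp
    linarith
  simp only [Matrix.mulVec_add, Matrix.mulVec_smul, Matrix.mulVec_mulVec, smul_add]
  congr 1
  · congr 1
    rw [smul_smul, mul_assoc _ p, hsq, mul_assoc (C * D), mul_inv_matSqrt hC]
  · rw [inv_smul_of_posDef hC hp.ne', Matrix.smul_mul, Matrix.mul_smul, Matrix.smul_mulVec,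
      smul_smul, smul_smul, ← mul_assoc (C * D * C), Matrix.mul_nonsing_inv_cancel_right _ _ hCu,
      mul_assoc C D, mul_inv_matSqrt hD]
    congr 1
    field_simp

end Matrices

namespace MarketData

variable {d : ℕ} {M : MarketData d}

/-! ### Consequences of the scaling assumptions -/

namespace ScalingAssumption

variable (hM : M.ScalingAssumption)
include hM

lemma τ_mem {u : ℝ} (hu : u ∈ Set.Ico (0 : ℝ) 1) : M.τ u ∈ Set.Ico (0 : ℝ) 1 := by
  have hu' : u ∈ Set.Icc (0 : ℝ) 1 := ⟨hu.1, hu.2.le⟩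
  constructor
  · rw [← hM.τ_zero]
    exact hM.τ_strictMonoOn.monotoneOn (by simp) hu' hu.1
  · rw [← hM.τ_one]
    exact hM.τ_strictMonoOn hu' (by simp) hu.2

lemma continuousOn_comp_τ {h : ℝ → ℝ} (hh : ContinuousOn h (Set.Ico 0 1)) :
    ContinuousOn (fun u => h (M.τ u)) (Set.Ico 0 1) :=
  hh.comp (hM.τ_continuousOn.mono Set.Ico_subset_Icc_self) fun _ hu => hM.τ_mem hu

lemma continuousOn_τ' : ContinuousOn M.τ' (Set.Ico 0 1) :=
  hM.τ_contDiffOn.continuousOn_derivWithin (uniqueDiffOn_Ico 0 1) le_rfl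

lemma continuousOn_sqrt_τ' : ContinuousOn (fun u => √(M.τ' u)) (Set.Ico 0 1) :=
  hM.continuousOn_τ'.sqrt

lemma continuousOn_lam : ContinuousOn M.lam (Set.Ico 0 1) :=
  (hM.p_continuousOn.mul hM.w_continuousOn).div hM.γ_continuousOn fun t ht => (hM.γ_pos t ht).ne'

lemma continuousOn_lam_div_τ' : ContinuousOn (fun u => M.lam (M.τ u) / M.τ' u) (Set.Ico 0 1) :=
  (hM.continuousOn_comp_τ hM.continuousOn_lam).div hM.continuousOn_τ'
    fun u hu => (hM.τ'_pos u hu).ne'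

lemma τInv_spec {t : ℝ} (ht : t ∈ Set.Ico (0 : ℝ) 1) :
    M.τInv t ∈ Set.Ico (0 : ℝ) 1 ∧ M.τ (M.τInv t) = t := by
  have hex : t ∈ M.τ '' Set.Icc 0 1 := by
    refine intermediate_value_Icc zero_le_one hM.τ_continuousOn ?_
    rw [hM.τ_zero, hM.τ_one]
    exact ⟨ht.1, ht.2.le⟩
  have h1 : M.τInv t ∈ Set.Icc (0 : ℝ) 1 := Function.invFunOn_mem hex
  have h2 : M.τ (M.τInv t) = t := Function.invFunOn_eq hex
  refine ⟨⟨h1.1, h1.2.lt_of_ne fun h => ?_⟩, h2⟩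
  rw [h, hM.τ_one] at h2
  exact ht.2.ne' h2

lemma signalTime_one (N : ℕ) : M.signalTime N 1 = 0 := by
  rw [signalTime, dyadic_one, hM.τ_zero]

lemma signalTime_le {s : ℝ} (hs : s ∈ Set.Ico (0 : ℝ) 1) {N n : ℕ}
    (hn : n ∈ dyadicIndices N (M.τInv s)) : M.signalTime N n ≤ s := by
  obtain ⟨hq, hτ⟩ := hM.τInv_spec hs
  have hd := dyadic_mem_Ico_of_mem hq.1 hq.2 hn
  rw [← hτ]
  exact hM.τ_strictMonoOn.monotoneOn ⟨hd.1, hd.2.le⟩ ⟨hq.1, hq.2.le⟩ (dyadic_le_of_mem hq.1 hn)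

/-- `p(0) C` is positive definite, and `C D C` is positive semidefinite with a nonnegative
coefficient. -/
lemma isUnit_det_limitPrecision {s : ℝ} (hs : s ∈ Set.Ico (0 : ℝ) 1) :
    IsUnit (M.limitPrecision s).det := by
  have hq := (hM.τInv_spec hs).1
  rw [← Matrix.isUnit_iff_isUnit_det]
  refine Matrix.PosDef.isUnit (Matrix.PosDef.add_posSemidef
    (hM.C_posDef.smul (hM.p_pos 0 (by simp))) (Matrix.PosSemidef.smul ?_ ?_))
  · have := hM.D_posDef.posSemidef.conjTranspose_mul_mul_same M.C
    rwa [hM.C_posDef.isHermitian.eq] at this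
  · refine intervalIntegral.integral_nonneg hq.1 fun u hu => ?_
    exact div_nonneg (sq_nonneg _) (hM.τ'_pos u ⟨hu.1, hu.2.trans_lt hq.2⟩).le

/-- The first weight has a positive limit, so dividing by `α_1` does not amplify the vanishing first
demand noise. -/
lemma tendsto_inv_riskTolerance_one : Tendsto (fun N => (M.riskTolerance N 1)⁻¹) atTop
    (𝓝 (((1 - M.w₀ - ∫ u in (0 : ℝ)..1, M.w (M.τ u)) / M.γ 0)⁻¹)) := by
  simp only [riskTolerance, hM.signalTime_one]
  refine (hM.weight_one_tendsto.div_const _).inv₀ (div_pos ?_ (hM.γ_pos 0 (by simp))).ne'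
  linarith [hM.w_integral_lt]

end ScalingAssumption

/-! ### Approximation of the limiting signal -/

section Approximation

variable {Ω : Type*} {mΩ : MeasurableSpace Ω} {P : Measure Ω} {B BY BZ X : ℝ≥0 → Ω → Fin d → ℝ}

/-- The weight of the `n`-th market signal, `n ≥ 2`, in the approximation of the limiting signal. -/
noncomputable def signalWeight (M : MarketData d) (N n : ℕ) : ℝ :=
  M.lam (M.τ (dyadic N n)) / M.τ' (dyadic N n) * M.riskTolerance N n * M.p (M.signalTime N n)

/-- The combination of the signals of the `N`-th market which approximates the limiting signal. -/
noncomputable def approxSignal (M : MarketData d) (P : Measure Ω) (BY BZ X : ℝ≥0 → Ω → Fin d → ℝ)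
    (s : ℝ) (N : ℕ) (ω : Ω) : Fin d → ℝ :=
  ((M.limitPrecision s)⁻¹).mulVec ((M.p 0 • M.C).mulVec (M.marketSignal P BY BZ X N 1 ω) +
    ∑ n ∈ dyadicIndices N (M.τInv s),
      M.signalWeight N n • (M.C * M.D * M.C).mulVec (M.marketSignal P BY BZ X N n ω))

lemma brownianFiltration_le (hB : ∀ t, Measurable (B t)) (t : ℝ) :
    brownianFiltration P B t ≤ mΩ :=
  sup_le (iSup_le fun s => (hB s).comap_le) (MeasurableSpace.generateFrom_le fun _ hA => hA.1)

@[fun_prop]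
lemma measurable_wienerIntegralVec (P : Measure Ω) (W : ℝ≥0 → Ω → Fin d → ℝ) (f : ℝ → ℝ)
    (a b : ℝ) : Measurable (wienerIntegralVec W P f a b) :=
  measurable_pi_lambda _ fun _ => measurable_wienerIntegral P _ f a b

lemma measurable_marketSignal (hBY : ∀ t, Measurable (BY t)) (hX : ∀ t, Measurable (X t))
    (N n : ℕ) : Measurable (M.marketSignal P BY BZ X N n) := by
  unfold marketSignal privateSignal privateNoise noiseDemand
  fun_prop

lemma measurable_limitSignal (hBY : ∀ t, Measurable (BY t)) (hX : ∀ t, Measurable (X t))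
    (s : ℝ) : Measurable (M.limitSignal P BY BZ X s) := by
  unfold limitSignal
  fun_prop

lemma publicFiltration_le (hB : ∀ t, Measurable (B t)) (hBY : ∀ t, Measurable (BY t))
    (hX : ∀ t, Measurable (X t)) (N : ℕ) (t : ℝ) : M.publicFiltration P B BY BZ X N t ≤ mΩ :=
  sup_le (brownianFiltration_le hB t)
    (iSup_le fun _ => (measurable_marketSignal hBY hX _ _).comap_le)

/-- Since `τ` is increasing, nodes up to `τ⁻¹(s)` carry signals that have arrived by time `s ≤ t`;
the first arrives at time `0`. -/
lemma measurable_approxSignal (hM : M.ScalingAssumption) {s t : ℝ} (hs : s ∈ Set.Ico (0 : ℝ) 1)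
    (hst : s ≤ t) (N : ℕ) :
    Measurable[M.publicFiltration P B BY BZ X N t] (M.approxSignal P BY BZ X s N) := by
  have hq := (hM.τInv_spec hs).1
  have hsignal : ∀ n, 1 ≤ n ∧ n ≤ 2 ^ N ∧ M.signalTime N n ≤ t →
      Measurable[M.publicFiltration P B BY BZ X N t] (M.marketSignal P BY BZ X N n) := fun n hn =>
    (comap_measurable (M.marketSignal P BY BZ X N n)).mono ((le_iSup (fun n : {n : ℕ // 1 ≤ n ∧
      n ≤ 2 ^ N ∧ M.signalTime N n ≤ t} => MeasurableSpace.comap (M.marketSignal P BY BZ X N n)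
        inferInstance) ⟨n, hn⟩).trans le_sup_right) le_rfl
  refine measurable_mulVec _ (Measurable.add (measurable_mulVec _ (hsignal 1
    ⟨le_rfl, Nat.one_le_two_pow, (hM.signalTime_one N).trans_le (hs.1.trans hst)⟩))
    (Finset.measurable_fun_sum _ fun n hn => ?_))
  refine Measurable.const_smul (measurable_mulVec _ (hsignal n ⟨?_, ?_, ?_⟩)) (M.signalWeight N n)
  · linarith [(Finset.mem_Icc.1 hn).1]
  · exact le_two_pow_of_mem hq.1 hq.2 hn
  · exact (hM.signalTime_le hs hn).trans hst

lemma riskTolerance_of_mem {N n : ℕ} {q : ℝ} (hn : n ∈ dyadicIndices N q) :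
    M.riskTolerance N n = M.w (M.signalTime N n) / M.γ (M.signalTime N n) * (1 / 2) ^ N := by
  have h2 := (Finset.mem_Icc.1 hn).1
  rw [riskTolerance, weight, if_neg (by lia), one_div, inv_pow]
  field_simp

/-- The noise parts of the approximating signals: the noise demand at time `0`, the weighted sum of
the noises in the private signals, and the weighted sum of the later noise demands. -/
noncomputable def approxNoise (M : MarketData d) (P : Measure Ω) (BY BZ : ℝ≥0 → Ω → Fin d → ℝ)
    (q : ℝ) (N : ℕ) (ω : Ω) : Fin 3 → Fin d → ℝ :=
  ![wienerIntegralVec BZ P (fun u => √(M.τ' u)) (dyadic N 1) (dyadic N (1 + 1)) ω,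
    ∑ n ∈ dyadicIndices N q,
      (M.lam (M.τ (dyadic N n)) / M.τ' (dyadic N n) * M.riskTolerance N n *
        √(M.p (M.signalTime N n))) • (BY (n : ℝ≥0) ω - BY ((n - 1 : ℕ) : ℝ≥0) ω),
    ∑ n ∈ dyadicIndices N q, (M.lam (M.τ (dyadic N n)) / M.τ' (dyadic N n)) •
      wienerIntegralVec BZ P (fun u => √(M.τ' u)) (dyadic N n) (dyadic N (n + 1)) ω]

/-- The signal with precision `F`, as a function of the deterministic coefficients and of the
noise. -/
noncomputable def signalOfNoise (M : MarketData d) (F : Matrix (Fin d) (Fin d) ℝ) (x y : Fin d → ℝ)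
    (r : ℝ × ℝ × (Fin 3 → Fin d → ℝ)) : Fin d → ℝ :=
  (F⁻¹).mulVec ((M.p 0 • M.C).mulVec x + √(M.p 0) • (matSqrt M.C).mulVec y +
    r.1 • ((matSqrt M.D)⁻¹).mulVec (r.2.2 0) + (r.2.1 • (M.C * M.D * M.C).mulVec x +
      (M.C * M.D * matSqrt M.C).mulVec (r.2.2 1) + (M.C * matSqrt M.D).mulVec (r.2.2 2)))

lemma continuous_signalOfNoise (F : Matrix (Fin d) (Fin d) ℝ) (x y : Fin d → ℝ) :
    Continuous (M.signalOfNoise F x y) := by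
  unfold signalOfNoise
  fun_prop

/-- Isolates the dependence on `N` in the arguments of one continuous function. The increment `BY 1
- BY 0` is kept because `BY 0 = 0` holds only almost surely. -/
lemma approxSignal_eq (hM : M.ScalingAssumption) {s : ℝ} (hs : s ∈ Set.Ico (0 : ℝ) 1) (N : ℕ)
    (ω : Ω) : M.approxSignal P BY BZ X s N ω =
      M.signalOfNoise (M.limitPrecision s) (X 1 ω) (BY 1 ω - BY 0 ω)
        ((M.riskTolerance N 1)⁻¹, ∑ n ∈ dyadicIndices N (M.τInv s), M.signalWeight N n,
          M.approxNoise P BY BZ (M.τInv s) N ω) := by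
  have hq := (hM.τInv_spec hs).1
  have h0 : (0 : ℝ) ∈ Set.Ico (0 : ℝ) 1 := by simp
  have hfirst : (M.p 0 • M.C).mulVec (M.marketSignal P BY BZ X N 1 ω) =
      (M.p 0 • M.C).mulVec (X 1 ω) + √(M.p 0) • (matSqrt M.C).mulVec (BY 1 ω - BY 0 ω) +
        (M.riskTolerance N 1)⁻¹ • ((matSqrt M.D)⁻¹).mulVec
          (wienerIntegralVec BZ P (fun u => √(M.τ' u)) (dyadic N 1) (dyadic N (1 + 1)) ω) := by
    rw [← smul_mulVec_signal_first hM.C_posDef (hM.p_pos 0 h0)]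
    simp [marketSignal, privateSignal, privateNoise, noiseDemand, precision, hM.signalTime_one]
  have hterm : ∀ n ∈ dyadicIndices N (M.τInv s),
      M.signalWeight N n • (M.C * M.D * M.C).mulVec (M.marketSignal P BY BZ X N n ω) = _ :=
    fun n hn => by
      have hmem := hM.τ_mem (dyadic_mem_Ico_of_mem hq.1 hq.2 hn)
      refine smul_mulVec_signal hM.C_posDef hM.D_posDef (hM.p_pos _ hmem) ?_
        (M.lam (M.τ (dyadic N n)) / M.τ' (dyadic N n)) _ _ _
      rw [riskTolerance_of_mem hn]
      exact (mul_pos (div_pos (hM.w_pos _ hmem) (hM.γ_pos _ hmem)) (by positivity)).ne'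
  rw [approxSignal, signalOfNoise, hfirst, Finset.sum_congr rfl hterm]
  simp only [Finset.sum_add_distrib, approxNoise, Matrix.mulVec_sum, Finset.sum_smul,
    Matrix.cons_val]
  rfl

/-- Write `X_1 = F⁻¹ F X_1` and expand `F`. The number `a` is free because it multiplies a noise
equal to `0`; it will be the limit of `1/α_1`. -/
lemma limitSignal_eq (hM : M.ScalingAssumption) {s : ℝ} (hs : s ∈ Set.Ico (0 : ℝ) 1) (a : ℝ)
    (ω : Ω) : M.limitSignal P BY BZ X s ω =
      M.signalOfNoise (M.limitPrecision s) (X 1 ω) (BY 1 ω)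
        (a, ∫ u in (0 : ℝ)..(M.τInv s), M.lam (M.τ u) ^ 2 / M.τ' u, ![0, 0,
          wienerIntegralVec BZ P (fun u => M.lam (M.τ u) / √(M.τ' u)) 0 (M.τInv s) ω]) := by
  have hF := hM.isUnit_det_limitPrecision hs
  have hX : X 1 ω = ((M.limitPrecision s)⁻¹).mulVec ((M.limitPrecision s).mulVec (X 1 ω)) := by
    rw [Matrix.mulVec_mulVec, Matrix.nonsing_inv_mul _ hF, Matrix.one_mulVec]
  rw [limitSignal, signalOfNoise]
  nth_rewrite 1 [hX]
  rw [← Matrix.mulVec_add]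
  congr 1
  nth_rewrite 1 [limitPrecision]
  simp only [Matrix.add_mulVec, Matrix.smul_mulVec, Matrix.cons_val, Matrix.mulVec_zero, smul_zero,
    add_zero]
  abel

lemma tendsto_sum_signalWeight (hM : M.ScalingAssumption) {q : ℝ} (hq : 0 ≤ q) (hq1 : q < 1) :
    Tendsto (fun N => ∑ n ∈ dyadicIndices N q, M.signalWeight N n) atTop
      (𝓝 (∫ u in (0 : ℝ)..q, M.lam (M.τ u) ^ 2 / M.τ' u)) := by
  have hcont : ContinuousOn (fun u => M.lam (M.τ u) ^ 2 / M.τ' u) (Set.Ico 0 1) :=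
    ((hM.continuousOn_comp_τ hM.continuousOn_lam).pow 2).div hM.continuousOn_τ'
      fun u hu => (hM.τ'_pos u hu).ne'
  refine (tendsto_dyadic_sum hcont hq hq1).congr fun N => Finset.sum_congr rfl fun n hn => ?_
  rw [signalWeight, riskTolerance_of_mem hn]
  simp only [lam, signalTime]
  ring

lemma tendstoInMeasure_noiseDemand_first (hM : M.ScalingAssumption) {W : ℝ≥0 → Ω → ℝ}
    (hW : IsPreBrownianReal W P) :
    TendstoInMeasure P (fun N =>
      wienerIntegral W P (fun u => √(M.τ' u)) (dyadic N 1) (dyadic N (1 + 1))) atTop 0 := by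
  have hd : ∀ N, dyadic N (1 + 1) = (1 / 2 : ℝ) ^ N := fun N => by
    rw [dyadic_succ, dyadic_one, zero_add]
  have hmem : ∀ b : ℝ, b < 1 → MemLp ((Set.Ioc 0 b).indicator fun u => √(M.τ' u)) 2 timeMeasure :=
    fun b hb => memLp_indicator_Ioc (hM.continuousOn_sqrt_τ'.mono fun x hx =>
      ⟨hx.1, hx.2.trans_lt hb⟩)
  have hlt : ∀ᶠ N : ℕ in atTop, (1 / 2 : ℝ) ^ N ≤ 1 / 2 := by
    filter_upwards [eventually_ge_atTop 1] with N hN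
    exact pow_le_of_le_one (by norm_num) (by norm_num) (by lia)
  -- A one-term sum, compared with the zero integrand on the empty interval `(0, 0]`.
  have key := tendstoInMeasure_sum_wienerIntegral hW (s := fun _ : ℕ => {1}) (c := fun _ _ => 1)
    (a := fun N n => dyadic N n) (b := fun N n => dyadic N (n + 1)) (f := fun u => √(M.τ' u))
    (g := 0) (α := 0) (β := 0) ?_ (by simp) ?_
  · refine (key.congr_right (wienerIntegral_zero_ae P W 0 0)).congr_left fun N => ?_
    simp
  · filter_upwards [hlt] with N hN
    intro n hn
    rw [Finset.mem_singleton.1 hn, dyadic_one, hd]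
    exact hmem _ (by linarith)
  · simp only [Finset.sum_singleton, dyadic_one, hd, one_mul, Set.Ioc_self, Set.indicator_empty,
      sub_zero]
    refine tendsto_eLpNorm_two_of_dominated (hmem (1 / 2) (by norm_num)) ?_ ?_ ?_
    · filter_upwards [hlt] with N hN
      exact (hmem _ (by linarith)).1
    · filter_upwards [hlt] with N hN
      refine .of_forall fun u => ?_
      rw [abs_of_nonneg (Set.indicator_nonneg (fun _ _ => Real.sqrt_nonneg _) _)]
      exact Set.indicator_le_indicator_of_subset (Set.Ioc_subset_Ioc_right hN)
        (fun _ => Real.sqrt_nonneg _) u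
    · refine .of_forall fun u => tendsto_const_nhds.congr' ?_
      rcases le_or_gt u 0 with hu | hu
      · exact .of_forall fun N => (Set.indicator_of_notMem (by simp [hu]) _).symm
      · have := (tendsto_pow_atTop_nhds_zero_of_lt_one (r := (1 / 2 : ℝ)) (by norm_num)
          (by norm_num)).eventually_lt_const hu
        filter_upwards [this] with N hN
        exact (Set.indicator_of_notMem (fun h => not_le.2 hN h.2) _).symm

/-- The coefficients are `2^{-N} ψ` at the nodes, with `ψ` bounded on `[0, q]`, and the increments
are Wiener integrals of `1` over disjoint unit intervals. -/
lemma tendstoInMeasure_privateNoise_sum (hM : M.ScalingAssumption) {W : ℝ≥0 → Ω → ℝ}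
    (hW : IsPreBrownianReal W P) {q : ℝ} (hq : 0 ≤ q) (hq1 : q < 1) :
    TendstoInMeasure P (fun N ω => ∑ n ∈ dyadicIndices N q,
      (M.lam (M.τ (dyadic N n)) / M.τ' (dyadic N n) * M.riskTolerance N n *
        √(M.p (M.signalTime N n))) * (W (n : ℝ≥0) ω - W ((n - 1 : ℕ) : ℝ≥0) ω)) atTop 0 := by
  set ψ : ℝ → ℝ := fun u => M.lam (M.τ u) / M.τ' u *
    (M.w (M.τ u) / M.γ (M.τ u)) * √(M.p (M.τ u)) with hψ
  have hψc : ContinuousOn ψ (Set.Ico 0 1) :=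
    (hM.continuousOn_lam_div_τ'.mul (hM.continuousOn_comp_τ
      (hM.w_continuousOn.div hM.γ_continuousOn fun t ht => (hM.γ_pos t ht).ne'))).mul
      (hM.continuousOn_comp_τ hM.p_continuousOn).sqrt
  obtain ⟨K, hK⟩ := isCompact_Icc.exists_bound_of_continuousOn
    (hψc.mono fun x (hx : x ∈ Set.Icc 0 q) => ⟨hx.1, hx.2.trans_lt hq1⟩)
  have key := tendstoInMeasure_sum_wienerIntegral hW (s := fun N => dyadicIndices N q)
    (c := fun N n => M.lam (M.τ (dyadic N n)) / M.τ' (dyadic N n) * M.riskTolerance N n *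
        √(M.p (M.signalTime N n)))
    (a := fun _ n => ((n - 1 : ℕ) : ℝ)) (b := fun _ n => (n : ℝ)) (f := 1)
    (g := 0) (α := 0) (β := 0) (.of_forall fun N n _ =>
      memLp_indicator_Ioc (continuousOn_const (c := (1 : ℝ)))) (by simp) ?_
  · refine (key.congr_right (wienerIntegral_zero_ae P W 0 0)).congr_left fun N => ?_
    have hinc : ∀ n : ℕ, wienerIntegral W P 1 ((n - 1 : ℕ) : ℝ) n =ᵐ[P]
        W (n : ℝ≥0) - W ((n - 1 : ℕ) : ℝ≥0) := fun n => by
      have := wienerIntegral_one_ae hW (a := ((n - 1 : ℕ) : ℝ≥0)) (b := (n : ℝ≥0))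
        (by exact_mod_cast Nat.sub_le n 1)
      simpa only [NNReal.coe_natCast] using this
    filter_upwards [ae_all_iff.2 hinc] with ω hω
    exact Finset.sum_congr rfl fun n _ => by rw [hω n, Pi.sub_apply]
  · simp only [Set.Ioc_self, Set.indicator_empty, sub_zero]
    refine tendsto_eLpNorm_unit_sum (K := K) (fun N n hn => ⟨?_, le_two_pow_of_mem hq hq1 hn⟩)
      fun N n hn => ?_
    · linarith [(Finset.mem_Icc.1 hn).1]
    · have h1 := hK _ ⟨(dyadic_pos_of_mem hn).le, dyadic_le_of_mem hq hn⟩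
      have h2 : M.lam (M.τ (dyadic N n)) / M.τ' (dyadic N n) * M.riskTolerance N n *
          √(M.p (M.signalTime N n)) = ψ (dyadic N n) * (1 / 2) ^ N := by
        rw [riskTolerance_of_mem hn, hψ]
        simp only [signalTime]
        ring
      rw [h2, abs_mul, abs_of_pos (by positivity : (0 : ℝ) < (1 / 2) ^ N)]
      gcongr
      exact h1

/-- Only the factor `λ/τ'` is discretised; `√τ'` is integrated exactly, and `(λ/τ') √τ' = λ/√τ'`. -/
lemma tendstoInMeasure_noiseDemand_sum (hM : M.ScalingAssumption) {W : ℝ≥0 → Ω → ℝ}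
    (hW : IsPreBrownianReal W P) {q : ℝ} (hq : 0 ≤ q) (hq1 : q < 1) :
    TendstoInMeasure P (fun N ω => ∑ n ∈ dyadicIndices N q,
      M.lam (M.τ (dyadic N n)) / M.τ' (dyadic N n) *
        wienerIntegral W P (fun u => √(M.τ' u)) (dyadic N n) (dyadic N (n + 1)) ω) atTop
      (wienerIntegral W P (fun u => M.lam (M.τ u) / √(M.τ' u)) 0 q) := by
  have hg : ∀ u ∈ Set.Ico (0 : ℝ) 1,
      M.lam (M.τ u) / √(M.τ' u) = M.lam (M.τ u) / M.τ' u * √(M.τ' u) := fun u hu => by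
    rw [div_mul, Real.div_sqrt]
  have hgc : ContinuousOn (fun u => M.lam (M.τ u) / √(M.τ' u)) (Set.Ico 0 1) :=
    (hM.continuousOn_comp_τ hM.continuousOn_lam).div hM.continuousOn_sqrt_τ'
      fun u hu => (Real.sqrt_pos.2 (hM.τ'_pos u hu)).ne'
  have hlim := tendsto_eLpNorm_stepSum_sub hM.continuousOn_lam_div_τ' hM.continuousOn_sqrt_τ' hq hq1
    hg
  have hmem := eventually_memLp_indicator_dyadic hM.continuousOn_sqrt_τ' hq hq1
  have hgmem := memLp_indicator_Ioc
    (hgc.mono fun x (hx : x ∈ Set.Icc 0 q) => ⟨hx.1, hx.2.trans_lt hq1⟩)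
  exact tendstoInMeasure_sum_wienerIntegral hW (s := fun N => dyadicIndices N q)
    (c := fun N n => M.lam (M.τ (dyadic N n)) / M.τ' (dyadic N n)) (a := fun N n => dyadic N n)
    (b := fun N n => dyadic N (n + 1))
    hmem hgmem hlim

lemma tendstoInMeasure_approxNoise (hM : M.ScalingAssumption) (hBY : IsBrownianVec BY P)
    (hBZ : IsBrownianVec BZ P) {q : ℝ} (hq : 0 ≤ q) (hq1 : q < 1) :
    TendstoInMeasure P (M.approxNoise P BY BZ q) atTop fun ω => ![0, 0,
      wienerIntegralVec BZ P (fun u => M.lam (M.τ u) / √(M.τ' u)) 0 q ω] := by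
  refine tendstoInMeasure_pi fun k => tendstoInMeasure_pi fun i => ?_
  have hY := (hBY.coord i).toIsPreBrownianReal
  have hZ := (hBZ.coord i).toIsPreBrownianReal
  fin_cases k
  · exact tendstoInMeasure_noiseDemand_first hM hZ
  · refine (tendstoInMeasure_privateNoise_sum hM hY hq hq1).congr_left
      fun N => .of_forall fun ω => ?_
    simp [approxNoise]
  · refine (tendstoInMeasure_noiseDemand_sum hM hZ hq hq1).congr_left
      fun N => .of_forall fun ω => ?_
    simp [approxNoise, wienerIntegralVec]

/-- Continuous mapping in probability through the subsequence criterion: along an almost surely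
convergent subsequence of the noises, `signalOfNoise` passes to the limit pathwise. -/
lemma tendstoInMeasure_approxSignal [IsFiniteMeasure P] (hM : M.ScalingAssumption)
    (hBY : IsBrownianVec BY P) (hBZ : IsBrownianVec BZ P) (hX : ∀ t, Measurable (X t)) {s : ℝ}
    (hs : s ∈ Set.Ico (0 : ℝ) 1) (i : Fin d) :
    TendstoInMeasure P (fun N ω => M.approxSignal P BY BZ X s N ω i) atTop
      fun ω => M.limitSignal P BY BZ X s ω i := by
  have hq := (hM.τInv_spec hs).1
  -- Ambient measurability is inherited from a public filtration; `BY` fills its Brownian slot,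
  -- since the approximating signal does not involve `B`.
  have hmeas : ∀ N, Measurable (M.approxSignal P BY BZ X s N) := fun N =>
    (measurable_approxSignal (B := BY) hM hs le_rfl N).mono
      (publicFiltration_le hBY.measurable hBY.measurable hX N s) le_rfl
  have hmeas_i : ∀ N, AEStronglyMeasurable (fun ω => M.approxSignal P BY BZ X s N ω i) P :=
    fun N => ((measurable_pi_apply i).comp (hmeas N)).aestronglyMeasurable
  refine (exists_seq_tendstoInMeasure_atTop_iff hmeas_i).2 ?_
  intro ns hns
  obtain ⟨ns', hns', hlim⟩ := ((tendstoInMeasure_approxNoise hM hBY hBZ hq.1 hq.2).comp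
    hns.tendsto_atTop).exists_seq_tendsto_ae
  refine ⟨ns', hns', ?_⟩
  have hzero : ∀ᵐ ω ∂P, BY 0 ω = 0 := by
    filter_upwards [ae_all_iff.2 fun j =>
      (hBY.coord j).toIsPreBrownianReal.eval_zero_ae_eq_zero] with ω hω
    exact funext hω
  filter_upwards [hlim, hzero] with ω hω h0
  simp only [approxSignal_eq hM hs, h0, sub_zero]
  rw [limitSignal_eq hM hs]
  have hsub := hns.tendsto_atTop.comp hns'.tendsto_atTop
  exact (((continuous_apply i).comp (continuous_signalOfNoise _ _ _)).tendsto _).comp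
    ((hM.tendsto_inv_riskTolerance_one.comp hsub).prodMk_nhds
      (((tendsto_sum_signalWeight hM hq.1 hq.2).comp hsub).prodMk_nhds hω))

lemma limitFiltration_le_asymptoticEvents [IsFiniteMeasure P] (hM : M.ScalingAssumption)
    (hB : ∀ t, Measurable (B t)) (hBY : IsBrownianVec BY P) (hBZ : IsBrownianVec BZ P)
    (hX : ∀ t, Measurable (X t)) {t : ℝ} (ht : t < 1) :
    M.limitFiltration P B BY BZ X t ≤
      asymptoticEvents P fun N => M.publicFiltration P B BY BZ X N t := by
  refine sup_le (le_asymptoticEvents (brownianFiltration_le hB t) fun N => le_sup_left)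
    (iSup_le fun s => ?_)
  have hs : (s : ℝ) ∈ Set.Ico (0 : ℝ) 1 := ⟨s.2.1, s.2.2.trans_lt ht⟩
  refine Measurable.comap_le (@measurable_pi_lambda _ _ _ (_) _ _ fun i => ?_)
  exact measurable_asymptoticEvents_of_tendstoInMeasure
    ((measurable_pi_apply i).comp (measurable_limitSignal hBY.measurable hX s))
    (fun N => (measurable_pi_apply i).comp (measurable_approxSignal hM hs s.2.2 N))
    (tendstoInMeasure_approxSignal hM hBY hBZ hX hs i)

end Approximation

end MarketData

end SignalLimit

theorem propositionP {Ω : Type*} {mΩ : MeasurableSpace Ω} (P : Measure Ω) [IsProbabilityMeasure P]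
    {d : ℕ} (κ σ : Matrix (Fin d) (Fin d) ℝ) (θ x₀ : Fin d → ℝ)
    (B BY BZ X : ℝ≥0 → Ω → Fin d → ℝ)
    (hB : SignalLimit.IsBrownianVec B P) (hBY : SignalLimit.IsBrownianVec BY P)
    (hBZ : SignalLimit.IsBrownianVec BZ P)
    (hindep : iIndepFun (fun (k : Fin 3) (ω : Ω) (t : ℝ≥0) => ![B, BY, BZ] k t ω) P)
    (hX : SignalLimit.IsOrnsteinUhlenbeck κ σ θ x₀ B X P)
    (M : SignalLimit.MarketData d) (hM : M.ScalingAssumption)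
    (p : ℝ≥0∞) (hp : 1 ≤ p) (hp_top : p ≠ ∞) :
    SignalLimit.FiltrationConvergesLp P p
      (fun N t => M.publicFiltration P B BY BZ X N t)
      (fun t => M.limitFiltration P B BY BZ X t) := by
  intro t ht
  exact SignalLimit.sigmaAlgebraConvergesLp_of_le_asymptoticEvents
    (fun N => SignalLimit.MarketData.publicFiltration_le hB.measurable hBY.measurable hX.measurable
      N t)
    (SignalLimit.MarketData.limitFiltration_le_asymptoticEvents hM hB.measurable hBY hBZ
      hX.measurable ht.2) hp hp_top
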